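/- Let $p_0,p_1,p_2$ be the corners of a triangle, let $\mathsf T_0$ be the triangle with its faces, and let $\mathsf T_{n+1}$ be the barycentric subdivision of $\mathsf T_n$. Let $\mathsf b(s)$ be the barycenter of a simplex $s$, and put $p'=\mathsf b([p_0,p_1,p_2])$ and $p'_k=\mathsf b([p_k,p_{k+1}])$ (indices of $p$ and $p'$ mod $3$). For $i=0,\dots,5$ let $F_i$ be the affine map with $F_i(p_0)=p'$, $F_i(p_1)=p_{\lceil i/2\rceil}$, $F_i(p_2)=p'_{\lfloor i/2\rfloor}$, and put $F_\omega=F_{\omega_1}\circ\cdots\circ F_{\omega_k}$ for $\omega\in\{0,\dots,5\}^k$, $k\ge 0$. Let $\ell_i=[p_{\lceil i/2\rceil},p'_{\lfloor i/2\rfloor}]$, $i=0,\dots,5$, be the six half-sides of the triangle. For a finite graph with conductances $c_{p,q}=c_{q,p}\ge 0$ put $\mathscr E(f)=\frac12\sum_{p,q}c_{p,q}(f(p)-f(q))^2$. The effective resistance between vertex sets $A,B$ is given by $R(A,B)^{-1}=\inf\{\mathscr E(f): f|_A=0,\ f|_B=1\}$. If vertices are identified, conductances of parallel edges add. *Hexacarpet.*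 The vertices of $G^H_n$ are the edges and the triangles of $\mathsf T_n$; each triangle is joined to its three edges, each time with the same conductance $\kappa>0$. For $n\ge1$, $R_n$ is the effective resistance in $G_n^H$ between the set $A^H_{(n)}$ of vertices contained in $\ell_0\cup\ell_1$ and the set $B^H_{(n)}$ of vertices contained in $\ell_3$ or in $\ell_4$. *1-skeleton.* $G^T_n$ is the graph of vertices and edges of $\mathsf T_n$; an edge lying in two triangles has conductance $1$, an edge lying in only one triangle has conductance $\beta>0$. $R_n^T$ is the effective resistance in $G_n^T$ between the vertices on $\ell_2$ and the vertices on $\ell_5$. *Shorted graph.* $\widetilde G^H_n$ is obtained from $G^H_n$ by identifying any two vertices that are both contained in $F_\omega([p_i,p_{i+1}])$ for some $i$ and some word $\omega$. Each side $[p_i,p_{i+1}]$ becomes a single vertex $\sigma_i$ of $\widetilde G^H_n$. *Gasket graphs.* $\Gamma_0$ is a star with three legs of conductance $\kappa$, whose tips are its corners $0,1,2$. $\Gamma_{n+1}$ consists of six copies (cells) $0,\dots,5$ of $\Gamma_n$, where for each $k\in\{0,1,2\}$ the corners $1$ of the cells $2k$ and $2k+1$ are identified, the corners $2$ of the cells $2k$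 and $2k+1$ are identified, and the corners $0$ of the cells $2k+1$ and $2k+2$ (mod $6$) are identified; its corner $k$ is the common corner $1$ of the cells $2k,2k+1$. (These are graph approximations of a non-p.c.f. Sierpinski gasket.) Then, for all $\kappa,\beta>0$: 1. For every $n\ge0$ there is an isomorphism of weighted graphs $\widetilde G^H_n\cong\Gamma_n$ taking $\sigma_k$ to the corner $k$, $k=0,1,2$. 2. The resistance of $\widetilde G^H_n$ scales exactly by $5/4$: for $i\ne j$ the effective resistance $\widetilde R_n$ between $\sigma_i$ and $\sigma_j$ in $\widetilde G^H_n$ is positive and $\widetilde R_{n+1}=\frac54\widetilde R_n$ for all $n\ge 0$. For $n\ge1$ the effective resistance in $\widetilde G^H_n$ between the images of $A^H_{(n)}$ and $B^H_{(n)}$ is also positive, also scales exactly by $5/4$, and is at most $R_n$. 3. There is a constant $c>0$ with $R_n\ge c\,(5/4)^n$ for all $n\ge1$. Consequently $\liminf_n\frac1n\log R_n\ge\log\frac54$; thus $\rho\ge 5/4$ for the resistance scaling constant $\rho$ given by $\log\rho=\lim_n\frac1n\log R_n$. 4. There is a constant $C$ with $0<R^T_n\le C\,(4/5)^n$ for all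 $n\ge1$. Consequently $\limsup_n\frac1n\log R^T_n\le\log\frac45$; thus $\rho^T\le 4/5$ for the constant $\rho^T$ given by $\log\rho^T=\lim_n\frac1n\log R^T_n$. -/

import Mathlib

open Filter Topology

noncomputable section

namespace Hexacarpet

/-! ### Finite weighted graphs: energy, effective resistance, identification of vertices -/

/-- The graph energy `ℰ(f) = ½ ∑_{(p,q)} c_{p,q} (f(p) - f(q))²` of a finite weighted graph with
conductances `c` (`c p q = 0` where there is no edge). -/
def graphEnergy {V : Type} [Finite V] (c : V → V → ℝ) (f : V → ℝ) : ℝ :=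
  (1 / 2) * ∑ᶠ x : V × V, c x.1 x.2 * (f x.1 - f x.2) ^ 2

/-- The effective resistance between two sets of vertices:
`R(A,B)⁻¹ = inf {ℰ(f) | f = 0 on A, f = 1 on B}`. -/
def effRes {V : Type} [Finite V] (c : V → V → ℝ) (A B : Set V) : ℝ :=
  (sInf {E : ℝ | ∃ f : V → ℝ, (∀ a ∈ A, f a = 0) ∧ (∀ b ∈ B, f b = 1) ∧ E = graphEnergy c f})⁻¹

/-- The conductances of the graph obtained by identifying equivalent vertices: conductances in
parallel add, `c̃_{P,Q} = ∑_{p ∈ P} ∑_{q ∈ Q} c_{p,q}`. -/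
def quotCond {V : Type} [Finite V] (s : Setoid V) (c : V → V → ℝ) (P Q : Quotient s) : ℝ :=
  ∑ᶠ (x : V × V) (_ : Quotient.mk s x.1 = P ∧ Quotient.mk s x.2 = Q), c x.1 x.2

/-! ### Iterated barycentric subdivision of a triangle -/

/-- The triangle is realized by its barycentric coordinates. -/
abbrev Pt : Type := Fin 3 → ℝ

/-- The corners `p_0, p_1, p_2` of the triangle. -/
def corner (i : Fin 3) : Pt := Pi.single i 1

/-- The barycenter `b(s)` of a simplex given by its finite set of vertices. -/
def bary (s : Finset Pt) : Pt := (s.card : ℝ)⁻¹ • ∑ x ∈ s, x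

/-- A finite two-dimensional simplicial complex: its vertices, its edges (as sets of two points)
and its triangles (as sets of three points). -/
structure TriComplex where
  verts : Finset Pt
  edges : Finset (Finset Pt)
  tris : Finset (Finset Pt)

/-- Barycentric subdivision. The new vertices are the old ones and the barycenters of edges and
triangles; the new edges are `[q₀, b[q₀,q₁]]`, `[q₀, b[q₀,q₁,q₂]]` and `[b[q₀,q₁], b[q₀,q₁,q₂]]`;
the new triangles are `[q₀, b[q₀,q₁], b[q₀,q₁,q₂]]`. -/
def subdivide (K : TriComplex) : TriComplex where
  verts := K.verts ∪ K.edges.image bary ∪ K.tris.image bary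
  edges :=
    (K.edges.biUnion fun e => e.image fun q => {q, bary e}) ∪
    (K.tris.biUnion fun t => t.image fun q => {q, bary t}) ∪
    (K.tris.biUnion fun t => (t.powersetCard 2).image fun e => {bary e, bary t})
  tris := K.tris.biUnion fun t => (t.powersetCard 2).biUnion fun e =>
    e.image fun q => {q, bary e, bary t}

/-- The complexes `T_n`: `T_0` is the triangle, `T_{n+1}` is the barycentric subdivision of
`T_n`. -/
def T : ℕ → TriComplex
  | 0 =>
    { verts := {corner 0, corner 1, corner 2}
      edges := {{corner 0, corner 1}, {corner 1, corner 2}, {corner 2, corner 0}}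
      tris := {{corner 0, corner 1, corner 2}} }
  | n + 1 => subdivide (T n)

/-- `p'`, the barycenter of the triangle. -/
def center : Pt := bary {corner 0, corner 1, corner 2}

/-- `p'_k`, the midpoint of the side `[p_k, p_{k+1}]` (indices mod 3). -/
def mid (k : Fin 3) : Pt := bary {corner k, corner (k + 1)}

/-- The corner `p_{⌈i/2⌉}` (index mod 3). -/
def outerCorner (i : Fin 6) : Pt := corner (Fin.ofNat 3 ((i.val + 1) / 2))

/-- The midpoint `p'_{⌊i/2⌋}`. -/
def outerMid (i : Fin 6) : Pt := mid (Fin.ofNat 3 (i.val / 2))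

/-- The self-similarity maps `F_0, …, F_5`: the affine maps of the triangle with `F_i(p_0) = p'`,
`F_i(p_1) = p_{⌈i/2⌉}` and `F_i(p_2) = p'_{⌊i/2⌋}`. -/
def F (i : Fin 6) (x : Pt) : Pt := x 0 • center + x 1 • outerCorner i + x 2 • outerMid i

/-- `F_w = F_{w_1} ∘ ⋯ ∘ F_{w_k}` for a word `w = w_1 ⋯ w_k` in `{0, …, 5}`. -/
def Fword (w : List (Fin 6)) (x : Pt) : Pt := w.foldr F x

/-- The geometric realization of the simplex `s` is contained in the segment `[p, q]`. -/
def InSegment (s : Finset Pt) (p q : Pt) : Prop := ∀ x ∈ s, x ∈ segment ℝ p q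

/-! ### The hexacarpet graph `G^H_n` -/

/-- The vertices of `G^H_n` are the edges and the triangles of `T_n`. -/
abbrev VH (n : ℕ) : Type := {x : Finset Pt // x ∈ (T n).edges ∪ (T n).tris}

/-- An edge of `T_n` is joined to each triangle that contains it, with conductance `κ`. -/
def condH (κ : ℝ) (n : ℕ) (x y : VH n) : ℝ :=
  if (x.1 ∈ (T n).edges ∧ y.1 ∈ (T n).tris ∧ x.1 ⊆ y.1) ∨
     (y.1 ∈ (T n).edges ∧ x.1 ∈ (T n).tris ∧ y.1 ⊆ x.1) then κ else 0

/-- `L^{(n,H)}_i`: the vertices of `G^H_n` in the half-side `[p_{⌈i/2⌉}, p'_{⌊i/2⌋}]`. -/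
def LH (n : ℕ) (i : Fin 6) : Set (VH n) := {x | InSegment x.1 (outerCorner i) (outerMid i)}

/-- `A^H_{(n)} = L_0 ∪ L_1`. -/
def AH (n : ℕ) : Set (VH n) := LH n 0 ∪ LH n 1

/-- `B^H_{(n)} = L_3 ∪ L_4`. -/
def BH (n : ℕ) : Set (VH n) := LH n 3 ∪ LH n 4

/-- `R_n`, the effective resistance between `A^H_{(n)}` and `B^H_{(n)}` in `G^H_n`. -/
def RH (κ : ℝ) (n : ℕ) : ℝ := effRes (condH κ n) (AH n) (BH n)

/-! ### The shorted hexacarpet graph -/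

/-- The equivalence relation generated by identifying any two vertices of `G^H_n` that both lie in
some `F_w([p_i, p_{i+1}])`, where `w` is a word of any length. -/
def shortSetoid (n : ℕ) : Setoid (VH n) :=
  Relation.EqvGen.setoid fun x y => ∃ (w : List (Fin 6)) (i : Fin 3),
    InSegment x.1 (Fword w (corner i)) (Fword w (corner (i + 1))) ∧
    InSegment y.1 (Fword w (corner i)) (Fword w (corner (i + 1)))

/-- The vertices of the shorted graph `G̃^H_n`. -/
abbrev VShort (n : ℕ) : Type := Quotient (shortSetoid n)

/-- The conductances of the shorted graph `G̃^H_n`. -/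
def condShort (κ : ℝ) (n : ℕ) : VShort n → VShort n → ℝ := quotCond (shortSetoid n) (condH κ n)

/-- The image in `G̃^H_n` of a set of vertices of `G^H_n`. -/
def shortImage (n : ℕ) (A : Set (VH n)) : Set (VShort n) := Quotient.mk (shortSetoid n) '' A

/-- The vertices of `G^H_n` in the side `[p_k, p_{k+1}]` of the triangle. -/
def sideH (n : ℕ) (k : Fin 3) : Set (VH n) := {x | InSegment x.1 (corner k) (corner (k + 1))}

/-- `R̃_n`: the effective resistance in `G̃^H_n` between two shorted sides of the triangle. -/
def RShort (κ : ℝ) (n : ℕ) (i j : Fin 3) : ℝ :=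
  effRes (condShort κ n) (shortImage n (sideH n i)) (shortImage n (sideH n j))

/-- The effective resistance in `G̃^H_n` between the images of `A^H_{(n)}` and `B^H_{(n)}`. -/
def RShortAB (κ : ℝ) (n : ℕ) : ℝ :=
  effRes (condShort κ n) (shortImage n (AH n)) (shortImage n (BH n))

/-! ### Graph approximations of the six-cell Sierpinski gasket

The cells `0, …, 5` are arranged in a cycle. Neighbouring cells share a corner of their own, and
for each `k` the cells `2k`, `2k+1` share a further corner, which is the `k`-th corner of the whole
gasket. Since `2 ^ n` cells of level `n` meet at a corner, the limit is not post-critically finite. -/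

/-- A finite weighted graph with three distinguished corners. -/
structure CornerNetwork where
  V : Type
  finite : Finite V
  cond : V → V → ℝ
  cor : Fin 3 → V

/-- The star with three legs of conductance `κ`; the tips of the legs are the corners. -/
def star (κ : ℝ) : CornerNetwork where
  V := Option (Fin 3)
  finite := inferInstance
  cond x y := if x.isSome = y.isSome then 0 else κ
  cor k := some k

/-- The cell `2k`. -/
def evenCell (k : Fin 3) : Fin 6 := Fin.ofNat 6 (2 * k.val)

/-- The cell `2k + 1`. -/
def oddCell (k : Fin 3) : Fin 6 := Fin.ofNat 6 (2 * k.val + 1)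

/-- The elementary identifications between corners of six copies of a network. -/
inductive GlueRel (N : CornerNetwork) : Fin 6 × N.V → Fin 6 × N.V → Prop
  /-- The cells `2k` and `2k+1` share the outer corner `k`. -/
  | outer (k : Fin 3) : GlueRel N (evenCell k, N.cor 1) (oddCell k, N.cor 1)
  /-- The cells `2k` and `2k+1` are neighbours. -/
  | inner (k : Fin 3) : GlueRel N (evenCell k, N.cor 2) (oddCell k, N.cor 2)
  /-- The cells `2k+1` and `2k+2` (mod 6) are neighbours. -/
  | next (k : Fin 3) : GlueRel N (oddCell k, N.cor 0) (evenCell (k + 1), N.cor 0)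

/-- Six disjoint copies of a network, glued at their corners. -/
def glueSix (N : CornerNetwork) : CornerNetwork :=
  haveI := N.finite
  { V := Quotient (Relation.EqvGen.setoid (GlueRel N))
    finite := inferInstance
    cond := quotCond (Relation.EqvGen.setoid (GlueRel N))
      fun x y => if x.1 = y.1 then N.cond x.2 y.2 else 0
    cor := fun k => Quotient.mk _ (evenCell k, N.cor 1) }

/-- The graph approximations of the six-cell gasket. -/
def gasket (κ : ℝ) : ℕ → CornerNetwork
  | 0 => star κ
  | n + 1 => glueSix (gasket κ n)

/-! ### The 1-skeleton `G^T_n` -/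

/-- The vertices of `G^T_n` are the vertices of `T_n`. -/
abbrev VT (n : ℕ) : Type := {q : Pt // q ∈ (T n).verts}

/-- The conductance of an edge of `T_n` is `1` if the edge lies in two triangles and `β` if it lies
in only one. -/
def condT (β : ℝ) (n : ℕ) (q q' : VT n) : ℝ :=
  if {q.1, q'.1} ∈ (T n).edges then
    if 2 ≤ ((T n).tris.filter fun t => {q.1, q'.1} ⊆ t).card then 1 else β
  else 0

/-- `L^{(n,T)}_i`: the vertices of `G^T_n` in the half-side `[p_{⌈i/2⌉}, p'_{⌊i/2⌋}]`. -/
def LT (n : ℕ) (i : Fin 6) : Set (VT n) := {q | q.1 ∈ segment ℝ (outerCorner i) (outerMid i)}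

/-- `R^T_n`, the effective resistance between `A^T_{(n)} = L_2` and `B^T_{(n)} = L_5` in
`G^T_n`. -/
def RT (β : ℝ) (n : ℕ) : ℝ := effRes (condT β n) (LT n 2) (LT n 5)

/-! ### Scaling constants -/

/-- `ρ` is the scaling constant of the sequence `R`: `log ρ = lim (1/n) log R_n`. -/
def IsScalingConstant (R : ℕ → ℝ) (ρ : ℝ) : Prop :=
  0 < ρ ∧ Tendsto (fun n : ℕ => Real.log (R n) / n) atTop (𝓝 (Real.log ρ))

end Hexacarpet

end

/-!
The shorted hexacarpet graph and the gasket graphs are built by the same recursion, and on the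
gasket graphs the minimal energy for given corner values can be computed exactly; planar duality
transfers the resulting bound to the 1-skeleton.

*Self-similarity.* In barycentric coordinates the six cell maps `F i` are linear and injective, and
the coordinates of `F i x` are the same three numbers in one of six arrangements. Hence the
sorted coordinates of `F i x` determine the point `x` of the triangle, whatever the cell `i` is
(`eq_of_F_eq_F`), and two cells meet only in points where their maps agree. As barycentric subdivision commutes with injective
linear maps, `T (n + 1)` is the union of the six images of `T n` (`isUnionOfCells_T`), and
`G^H_{n+1}` is obtained from six copies of `G^H_n` by identifying vertices (`pushCond_cellMap`).
Composing with the shorting relation, a simplex in a common side of two cells becomes a common corner, and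
induction on `n` gives the isomorphism with the gasket graph (`IsShorting.succ`).

*Exact scaling.* The energy of a glued network is the sum of the energies of its cells. Therefore
the trace of the energy of `Γ_n` on the corners is a multiple `traceCond κ n` of the energy of a
triangle, and by an explicit harmonic extension this multiple is divided by `5/4` at each level
(`sum_triForm_cellValues`). The resistances in the shorted graph follow, and shorting does not
increase resistances, which bounds `R_n` from below.

*Duality.* For `f` on the 1-skeleton and `h` on the hexacarpet graph consider the sum of
`(f(b) - f(a)) (h([a,b]) - h(t))` over the triangles `t` and their oriented edges `[a,b]`. By a
discrete Stokes formula (`pairing_eq_sum_sideSum`) it depends only on the boundary values, and it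
equals `1` for admissible `f` and `h` (`pairing_eq_one`). By the Cauchy–Schwarz inequality the
product of the energies of `f` and `h` is bounded below (`one_le_energy_mul_energy`), as an edge
lies in at most two triangles (`card_tris_le`). With `h` the potential of the shorted graph this is the
upper bound for `R^T_n`. With any fixed `f` it shows that the energies of the admissible `h` have a
positive lower bound, so that `R_n` is not the inverse of `0` in the comparison with the shorted
graph.
-/

namespace Hexacarpet

/-! ### Push-forward of conductances -/

instance (N : CornerNetwork) : Finite N.V := N.finite

theorem graphEnergy_eq_sum {V : Type} [Fintype V] (c : V → V → ℝ) (f : V → ℝ) :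
    graphEnergy c f = (1 / 2) * ∑ x : V × V, c x.1 x.2 * (f x.1 - f x.2) ^ 2 := by
  rw [graphEnergy, finsum_eq_sum_of_fintype]

/-- The push-forward of conductances along a map `π`, the points of each fibre of `π` being
identified. For the projection to a quotient it is `quotCond`. -/
noncomputable def pushCond {X Y : Type} (π : X → Y) (c : X → X → ℝ) (P Q : Y) : ℝ :=
  ∑ᶠ (x : X × X) (_ : π x.1 = P ∧ π x.2 = Q), c x.1 x.2

theorem pushCond_eq_sum {X Y : Type} [Fintype X] [DecidableEq Y] (π : X → Y) (c : X → X → ℝ)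
    (P Q : Y) :
    pushCond π c P Q = ∑ x : X × X, if Prod.map π π x = (P, Q) then c x.1 x.2 else 0 := by
  rw [pushCond, finsum_eq_sum_of_fintype]
  refine Finset.sum_congr rfl fun x _ => ?_
  simp only [Prod.map, Prod.mk.injEq]
  rw [finsum_eq_if]

theorem sum_pushCond_mul {X Y : Type} [Fintype X] [Fintype Y] (π : X → Y)
    (c : X → X → ℝ) (g : Y × Y → ℝ) :
    ∑ y : Y × Y, pushCond π c y.1 y.2 * g y = ∑ x : X × X, c x.1 x.2 * g (Prod.map π π x) := by
  classical
  simp only [pushCond_eq_sum, Finset.sum_mul, ite_mul, zero_mul]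
  rw [Finset.sum_comm]
  simp

theorem graphEnergy_pushCond {X Y : Type} [Finite X] [Finite Y] (π : X → Y)
    (c : X → X → ℝ) (f : Y → ℝ) : graphEnergy (pushCond π c) f = graphEnergy c (f ∘ π) := by
  have := Fintype.ofFinite X
  have := Fintype.ofFinite Y
  rw [graphEnergy_eq_sum, graphEnergy_eq_sum,
    sum_pushCond_mul π c fun y => (f y.1 - f y.2) ^ 2]
  rfl

theorem pushCond_comp {X Y Z : Type} [Finite X] [Finite Y] (π : X → Y) (ϖ : Y → Z)
    (c : X → X → ℝ) : pushCond ϖ (pushCond π c) = pushCond (ϖ ∘ π) c := by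
  classical
  have := Fintype.ofFinite X
  have := Fintype.ofFinite Y
  ext P Q
  rw [pushCond_eq_sum, pushCond_eq_sum]
  have := sum_pushCond_mul π c fun y => if Prod.map ϖ ϖ y = (P, Q) then 1 else 0
  simpa only [mul_ite, mul_one, mul_zero, Prod.map_map] using this

theorem pushCond_apply_of_injective {X Y : Type} [Finite X] {π : X → Y}
    (hπ : Function.Injective π) (c : X → X → ℝ) (x y : X) :
    pushCond π c (π x) (π y) = c x y := by
  classical
  have := Fintype.ofFinite X
  rw [pushCond_eq_sum, Finset.sum_eq_single (x, y)]
  · simp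
  · rintro ⟨a, b⟩ - h
    simp only [Prod.map, Prod.mk.injEq, hπ.eq_iff]
    rw [if_neg]
    simpa using h
  · simp

/-- The conductances of disjoint copies, indexed by `ι`, of a network. -/
noncomputable def copiesCond {ι V : Type} [DecidableEq ι] (c : V → V → ℝ) (x y : ι × V) : ℝ :=
  if x.1 = y.1 then c x.2 y.2 else 0

theorem graphEnergy_copiesCond {ι V : Type} [DecidableEq ι] [Fintype ι] [Finite V]
    (c : V → V → ℝ) (f : ι × V → ℝ) :
    graphEnergy (copiesCond c) f = ∑ i, graphEnergy c fun v => f (i, v) := by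
  have := Fintype.ofFinite V
  simp only [graphEnergy_eq_sum, copiesCond, ← Finset.mul_sum, Fintype.sum_prod_type, ite_mul,
    zero_mul]
  congr 1
  refine Finset.sum_congr rfl fun i _ => Finset.sum_congr rfl fun v _ => ?_
  rw [Finset.sum_comm]
  simp

theorem pushCond_copiesCond {ι V W : Type} [DecidableEq ι] [Finite ι] [Finite V]
    (π : V → W) (c : V → V → ℝ) :
    pushCond (Prod.map (id : ι → ι) π) (copiesCond c) = copiesCond (pushCond π c) := by
  classical
  have := Fintype.ofFinite V
  have := Fintype.ofFinite ι
  ext ⟨i, P⟩ ⟨j, Q⟩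
  rw [pushCond_eq_sum, copiesCond]
  simp only [pushCond_eq_sum, copiesCond, Fintype.sum_prod_type, Prod.map, Prod.mk.injEq, id]
  by_cases hij : i = j
  · subst hij
    simp only [if_true]
    rw [Finset.sum_eq_single i]
    · refine Finset.sum_congr rfl fun v _ => ?_
      rw [Finset.sum_eq_single i]
      · simp
      · intro k _ hk
        simp [hk]
      · simp
    · intro k _ hk
      simp [hk]
    · simp
  · rw [if_neg hij]
    refine Finset.sum_eq_zero fun k _ => Finset.sum_eq_zero fun v _ =>
      Finset.sum_eq_zero fun l _ => Finset.sum_eq_zero fun w _ => ?_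
    rw [ite_eq_right_iff, ite_eq_right_iff]
    rintro ⟨⟨rfl, -⟩, rfl, -⟩ rfl
    exact absurd rfl hij

theorem graphEnergy_nonneg {V : Type} [Finite V] {c : V → V → ℝ} (hc : ∀ p q, 0 ≤ c p q)
    (f : V → ℝ) : 0 ≤ graphEnergy c f := by
  have := Fintype.ofFinite V
  rw [graphEnergy_eq_sum]
  exact mul_nonneg (by norm_num)
    (Finset.sum_nonneg fun x _ => mul_nonneg (hc _ _) (sq_nonneg _))

/-! ### Effective resistance -/

/-- An attained minimum of the energy determines the effective resistance. -/
theorem effRes_eq_inv {V : Type} [Finite V] {c : V → V → ℝ} {A B : Set V} {m : ℝ}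
    (hle : ∀ f : V → ℝ, (∀ a ∈ A, f a = 0) → (∀ b ∈ B, f b = 1) → m ≤ graphEnergy c f)
    (hex : ∃ f : V → ℝ, (∀ a ∈ A, f a = 0) ∧ (∀ b ∈ B, f b = 1) ∧ graphEnergy c f = m) :
    effRes c A B = m⁻¹ := by
  rw [effRes, IsLeast.csInf_eq (a := m)]
  constructor
  · obtain ⟨f, h0, h1, h⟩ := hex
    exact ⟨f, h0, h1, h.symm⟩
  · rintro _ ⟨f, h0, h1, rfl⟩
    exact hle f h0 h1

/-- A positive lower bound for the energy of all admissible functions is an upper bound for the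
resistance; a single admissible function makes the resistance positive. -/
theorem effRes_pos_and_le {V : Type} [Finite V] {c : V → V → ℝ} {A B : Set V} {m : ℝ} (hm : 0 < m)
    (hle : ∀ f : V → ℝ, (∀ a ∈ A, f a = 0) → (∀ b ∈ B, f b = 1) → m ≤ graphEnergy c f)
    (hex : ∃ f : V → ℝ, (∀ a ∈ A, f a = 0) ∧ (∀ b ∈ B, f b = 1)) :
    0 < effRes c A B ∧ effRes c A B ≤ m⁻¹ := by
  have h : m ≤ sInf {E : ℝ | ∃ f : V → ℝ, (∀ a ∈ A, f a = 0) ∧ (∀ b ∈ B, f b = 1) ∧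
      E = graphEnergy c f} := by
    obtain ⟨f, h0, h1⟩ := hex
    refine le_csInf ⟨_, f, h0, h1, rfl⟩ ?_
    rintro _ ⟨f, h0, h1, rfl⟩
    exact hle f h0 h1
  exact ⟨inv_pos.2 (hm.trans_le h), inv_anti₀ hm h⟩

/-- The energy of an admissible function bounds the resistance from below, provided that the
energies of the admissible functions have a positive lower bound. -/
theorem inv_graphEnergy_le_effRes {V : Type} [Finite V] {c : V → V → ℝ} {A B : Set V} {m : ℝ}
    (hm : 0 < m)
    (hle : ∀ f : V → ℝ, (∀ a ∈ A, f a = 0) → (∀ b ∈ B, f b = 1) → m ≤ graphEnergy c f)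
    {f : V → ℝ} (h0 : ∀ a ∈ A, f a = 0) (h1 : ∀ b ∈ B, f b = 1) :
    (graphEnergy c f)⁻¹ ≤ effRes c A B := by
  have hlow : ∀ E ∈ {E : ℝ | ∃ f : V → ℝ, (∀ a ∈ A, f a = 0) ∧ (∀ b ∈ B, f b = 1) ∧
      E = graphEnergy c f}, m ≤ E := by
    rintro _ ⟨f, h0, h1, rfl⟩
    exact hle f h0 h1
  exact inv_anti₀ (hm.trans_le (le_csInf ⟨_, f, h0, h1, rfl⟩ hlow))
    (csInf_le ⟨m, hlow⟩ ⟨f, h0, h1, rfl⟩)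

/-! ### The trace of the gasket energy on the corners -/

/-- The energy of a triangle with unit conductances. -/
def triForm (u : Fin 3 → ℝ) : ℝ := (u 0 - u 1) ^ 2 + (u 1 - u 2) ^ 2 + (u 2 - u 0) ^ 2

/-- The vertex of the six-cell gasket which is the corner `j` of the cell `i`. -/
def gluedCorner (N : CornerNetwork) (i : Fin 6) (j : Fin 3) : (glueSix N).V :=
  Quotient.mk (Relation.EqvGen.setoid (GlueRel N)) (i, N.cor j)

theorem gluedCorner_outer (N : CornerNetwork) (k : Fin 3) :
    gluedCorner N (evenCell k) 1 = gluedCorner N (oddCell k) 1 :=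
  Quotient.sound (Relation.EqvGen.rel _ _ (.outer k))

theorem gluedCorner_inner (N : CornerNetwork) (k : Fin 3) :
    gluedCorner N (evenCell k) 2 = gluedCorner N (oddCell k) 2 :=
  Quotient.sound (Relation.EqvGen.rel _ _ (.inner k))

theorem gluedCorner_next (N : CornerNetwork) (k : Fin 3) :
    gluedCorner N (oddCell k) 0 = gluedCorner N (evenCell (k + 1)) 0 :=
  Quotient.sound (Relation.EqvGen.rel _ _ (.next k))

theorem sum_cells {M : Type*} [AddCommMonoid M] (a : Fin 6 → M) :
    ∑ i, a i = ∑ k, (a (evenCell k) + a (oddCell k)) := by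
  rw [Fin.sum_univ_six, Fin.sum_univ_three]
  change _ = a 0 + a 1 + (a 2 + a 3) + (a 4 + a 5)
  simp only [add_assoc]

theorem glueSix_cond (N : CornerNetwork) : (glueSix N).cond =
    pushCond (Quotient.mk (Relation.EqvGen.setoid (GlueRel N))) (copiesCond N.cond) := rfl

theorem graphEnergy_glueSix (N : CornerNetwork) (f : (glueSix N).V → ℝ) :
    graphEnergy (glueSix N).cond f = ∑ i : Fin 6, graphEnergy N.cond fun v =>
      f (Quotient.mk (Relation.EqvGen.setoid (GlueRel N)) (i, v)) := by
  rw [glueSix_cond]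
  exact (graphEnergy_pushCond _ _ _).trans (graphEnergy_copiesCond _ _)

/-- The values at the corners `0, 1, 2` of the cell `i` of the six-cell gasket, for the values `u`
at the outer corners, `v` at the vertices common to the cells `2k` and `2k+1`, and `w` at the
vertices common to the cells `2k+1` and `2k+2`. -/
def cellValues (u v w : Fin 3 → ℝ) : Fin 6 → Fin 3 → ℝ :=
  ![![w 2, u 0, v 0], ![w 0, u 0, v 0], ![w 0, u 1, v 1], ![w 1, u 1, v 1], ![w 1, u 2, v 2],
    ![w 2, u 2, v 2]]

/-- The harmonic extension of the corner values `u` to the vertices common to the cells `2k` and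
`2k+1`. -/
noncomputable def harmInner (u : Fin 3 → ℝ) (k : Fin 3) : ℝ :=
  (11 * u k + 2 * u (k + 1) + 2 * u (k + 2)) / 15

/-- The harmonic extension of the corner values `u` to the vertices common to the cells `2k+1` and
`2k+2`. -/
noncomputable def harmNext (u : Fin 3 → ℝ) (k : Fin 3) : ℝ :=
  (7 * u k + 7 * u (k + 1) + u (k + 2)) / 15

theorem fin3_one_add_one : (1 : Fin 3) + 1 = 2 := rfl
theorem fin3_one_add_two : (1 : Fin 3) + 2 = 0 := rfl
theorem fin3_two_add_one : (2 : Fin 3) + 1 = 0 := rfl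
theorem fin3_two_add_two : (2 : Fin 3) + 2 = 1 := rfl

/-- Green's formula on the one-level network: the energy is the energy of the harmonic extension,
which is `4/5` of the triangle energy of the corner values, plus the energy of the difference. -/
theorem sum_triForm_cellValues (u v w : Fin 3 → ℝ) :
    ∑ i, triForm (cellValues u v w i) = 4 / 5 * triForm u +
      ∑ i, triForm (cellValues 0 (v - harmInner u) (w - harmNext u) i) := by
  simp only [Fin.sum_univ_six, cellValues, triForm, harmInner, harmNext, Matrix.cons_val,
    Pi.sub_apply, Pi.zero_apply, fin3_one_add_one, fin3_one_add_two, fin3_two_add_one,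
    fin3_two_add_two, zero_add]
  ring

theorem triForm_nonneg (u : Fin 3 → ℝ) : 0 ≤ triForm u := by
  unfold triForm
  positivity

theorem four_fifths_triForm_le (u v w : Fin 3 → ℝ) :
    4 / 5 * triForm u ≤ ∑ i, triForm (cellValues u v w i) := by
  rw [sum_triForm_cellValues]
  exact le_add_of_nonneg_right (Finset.sum_nonneg fun i _ => triForm_nonneg _)

theorem sum_triForm_harmonic (u : Fin 3 → ℝ) :
    ∑ i, triForm (cellValues u (harmInner u) (harmNext u) i) = 4 / 5 * triForm u := by
  rw [sum_triForm_cellValues]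
  simp [cellValues, triForm]

/-- The corner values in the cells of a function on the six-cell gasket are of the form
`cellValues`. -/
theorem cellValues_gluedCorner (N : CornerNetwork) (f : (glueSix N).V → ℝ) (i : Fin 6) :
    (fun j => f (gluedCorner N i j)) = cellValues (fun k => f ((glueSix N).cor k))
      (fun k => f (gluedCorner N (evenCell k) 2)) (fun k => f (gluedCorner N (oddCell k) 0)) i := by
  have h0 := gluedCorner_outer N
  have h1 := gluedCorner_inner N
  have h2 := gluedCorner_next N
  have hc : ∀ k, (glueSix N).cor k = gluedCorner N (evenCell k) 1 := fun k => rfl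
  ext j
  rw [funext hc]
  fin_cases i <;> fin_cases j
  · exact congrArg f (h2 2).symm
  · rfl
  · rfl
  · rfl
  · exact congrArg f (h0 0).symm
  · exact congrArg f (h1 0).symm
  · exact congrArg f (h2 0).symm
  · rfl
  · rfl
  · rfl
  · exact congrArg f (h0 1).symm
  · exact congrArg f (h1 1).symm
  · exact congrArg f (h2 1).symm
  · rfl
  · rfl
  · rfl
  · exact congrArg f (h0 2).symm
  · exact congrArg f (h1 2).symm

/-- Functions on the cells which agree with given values at the corners glue to a function on the
six-cell gasket. -/
theorem exists_glued_function (N : CornerNetwork) (u v w : Fin 3 → ℝ) (g : Fin 6 → N.V → ℝ)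
    (hg : ∀ i j, g i (N.cor j) = cellValues u v w i j) :
    ∃ f : (glueSix N).V → ℝ, (∀ k, f ((glueSix N).cor k) = u k) ∧
      ∀ i a, f (Quotient.mk (Relation.EqvGen.setoid (GlueRel N)) (i, a)) = g i a := by
  have key : ∀ x y : Fin 6 × N.V, Relation.EqvGen (GlueRel N) x y → g x.1 x.2 = g y.1 y.2 := by
    intro x y h
    induction h with
    | rel _ _ h =>
      cases h with
      | outer k => rw [hg, hg]; fin_cases k <;> rfl
      | inner k => rw [hg, hg]; fin_cases k <;> rfl
      | next k => rw [hg, hg]; fin_cases k <;> rfl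
    | refl => rfl
    | symm _ _ _ ih => exact ih.symm
    | trans _ _ _ _ _ ih ih' => exact ih.trans ih'
  refine ⟨Quotient.lift (fun x : Fin 6 × N.V => g x.1 x.2) key, fun k => ?_, fun i a => rfl⟩
  refine (hg (evenCell k) 1).trans ?_
  fin_cases k <;> rfl

/-- The conductance of the triangle to which the level-`n` gasket graph is equivalent at its
corners: a star of legs `κ` is a triangle of conductances `κ / 3`, and each level multiplies the
conductances by `4 / 5`. -/
noncomputable def traceCond (κ : ℝ) (n : ℕ) : ℝ := κ / 3 * (4 / 5) ^ n

theorem traceCond_pos {κ : ℝ} (hκ : 0 < κ) (n : ℕ) : 0 < traceCond κ n := by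
  unfold traceCond
  positivity

theorem traceCond_succ (κ : ℝ) (n : ℕ) : traceCond κ (n + 1) = traceCond κ n * (4 / 5) := by
  unfold traceCond
  ring

theorem graphEnergy_star (κ : ℝ) (f : (star κ).V → ℝ) :
    graphEnergy (star κ).cond f =
      κ * ∑ k, (f ((star κ).cor k) - f (none : Option (Fin 3))) ^ 2 := by
  have h := graphEnergy_eq_sum (V := Option (Fin 3)) (star κ).cond f
  refine h.trans ?_
  simp only [Fintype.sum_prod_type, Fintype.sum_option, star, Option.isSome_none,
    Option.isSome_some, Fin.sum_univ_three]
  simp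
  ring

/-- The trace of the energy of the gasket graph on its corners is bounded below by a multiple of
the energy of a triangle. -/
theorem traceCond_mul_triForm_le {κ : ℝ} (hκ : 0 < κ) (n : ℕ) (f : (gasket κ n).V → ℝ) :
    traceCond κ n * triForm (fun k => f ((gasket κ n).cor k)) ≤
      graphEnergy (gasket κ n).cond f := by
  induction n with
  | zero =>
    refine le_of_le_of_eq ?_ (graphEnergy_star κ f).symm
    have key : ∀ a b c x : ℝ, 1 / 3 * ((a - b) ^ 2 + (b - c) ^ 2 + (c - a) ^ 2) ≤
        (a - x) ^ 2 + (b - x) ^ 2 + (c - x) ^ 2 := fun a b c x => by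
      nlinarith [sq_nonneg (a + b + c - 3 * x)]
    have := mul_le_mul_of_nonneg_left (key (f ((star κ).cor 0)) (f ((star κ).cor 1))
      (f ((star κ).cor 2)) (f (none : Option (Fin 3)))) hκ.le
    rw [Fin.sum_univ_three]
    refine le_of_eq_of_le ?_ this
    unfold traceCond triForm
    rw [pow_zero]
    change κ / 3 * 1 * ((f ((star κ).cor 0) - f ((star κ).cor 1)) ^ 2 +
      (f ((star κ).cor 1) - f ((star κ).cor 2)) ^ 2 +
      (f ((star κ).cor 2) - f ((star κ).cor 0)) ^ 2) = _
    ring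
  | succ n ih =>
    refine le_of_le_of_eq ?_ (graphEnergy_glueSix (gasket κ n) f).symm
    refine le_trans ?_ (Finset.sum_le_sum fun i _ => ih _)
    rw [← Finset.mul_sum, traceCond_succ, mul_assoc]
    refine mul_le_mul_of_nonneg_left ?_ (traceCond_pos hκ n).le
    refine (four_fifths_triForm_le _ (fun k => f (gluedCorner (gasket κ n) (evenCell k) 2))
      fun k => f (gluedCorner (gasket κ n) (oddCell k) 0)).trans_eq
      (Finset.sum_congr rfl fun i _ => ?_)
    exact congrArg triForm (cellValues_gluedCorner (gasket κ n) f i).symm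

/-- The lower bound of `traceCond_mul_triForm_le` is attained for all corner values. -/
theorem exists_graphEnergy_gasket_eq (κ : ℝ) (n : ℕ) (u : Fin 3 → ℝ) :
    ∃ f : (gasket κ n).V → ℝ, (∀ k, f ((gasket κ n).cor k) = u k) ∧
      graphEnergy (gasket κ n).cond f = traceCond κ n * triForm u := by
  induction n generalizing u with
  | zero =>
    refine ⟨fun x : Option (Fin 3) => x.elim ((u 0 + u 1 + u 2) / 3) u, fun k => rfl, ?_⟩
    refine (graphEnergy_star κ _).trans ?_
    rw [Fin.sum_univ_three]
    change κ * ((u 0 - (u 0 + u 1 + u 2) / 3) ^ 2 + (u 1 - (u 0 + u 1 + u 2) / 3) ^ 2 +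
      (u 2 - (u 0 + u 1 + u 2) / 3) ^ 2) = _
    unfold traceCond triForm
    ring
  | succ n ih =>
    choose g hg hE using fun i => ih (cellValues u (harmInner u) (harmNext u) i)
    obtain ⟨f, hf, hfg⟩ := exists_glued_function (gasket κ n) u (harmInner u) (harmNext u) g hg
    refine ⟨f, hf, (graphEnergy_glueSix (gasket κ n) f).trans ?_⟩
    simp only [hfg, hE, ← Finset.mul_sum, sum_triForm_harmonic, traceCond_succ]
    ring

/-! ### The six cell maps -/

theorem corner_injective : Function.Injective corner := fun i j h => by
  by_contra hij
  have := congrFun h i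
  simp [corner, hij] at this

theorem corner_ne {i j : Fin 3} (h : i ≠ j) : corner i ≠ corner j := corner_injective.ne h

theorem fin3_ne_add_one (k : Fin 3) : k ≠ k + 1 := by decide +revert

theorem center_eq : center = fun _ => 1 / 3 := by
  have h : ({corner 0, corner 1, corner 2} : Finset Pt).card = 3 :=
    Finset.card_eq_three.2 ⟨_, _, _, corner_ne (by decide), corner_ne (by decide),
      corner_ne (by decide), rfl⟩
  have h0 : corner 0 ∉ ({corner 1, corner 2} : Finset Pt) := by
    simp [corner_injective.eq_iff]
  rw [center, bary, h, Finset.sum_insert h0, Finset.sum_pair (corner_ne (by decide))]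
  ext j
  fin_cases j <;> simp [corner]

theorem mid_eq (k : Fin 3) : mid k = (2 : ℝ)⁻¹ • (corner k + corner (k + 1)) := by
  have h := corner_ne (fin3_ne_add_one k)
  rw [mid, bary, Finset.card_pair h, Finset.sum_pair h]
  norm_num

theorem outerCorner_eq (i : Fin 6) : outerCorner i = corner (![0, 1, 1, 2, 2, 0] i) := by
  fin_cases i <;> rfl

theorem outerMid_eq (i : Fin 6) : outerMid i = mid (![0, 0, 1, 1, 2, 2] i) := by
  fin_cases i <;> rfl

/-- In each cell the coordinates of `F i x` are the same three numbers, in increasing order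
`x₀/3 ≤ x₀/3 + x₂/2 ≤ x₀/3 + x₁ + x₂/2`, in one of the six possible arrangements. -/
theorem F_eq (i : Fin 6) (x : Pt) : F i x =
    ![![x 0 / 3 + x 1 + x 2 / 2, x 0 / 3 + x 2 / 2, x 0 / 3],
      ![x 0 / 3 + x 2 / 2, x 0 / 3 + x 1 + x 2 / 2, x 0 / 3],
      ![x 0 / 3, x 0 / 3 + x 1 + x 2 / 2, x 0 / 3 + x 2 / 2],
      ![x 0 / 3, x 0 / 3 + x 2 / 2, x 0 / 3 + x 1 + x 2 / 2],
      ![x 0 / 3 + x 2 / 2, x 0 / 3, x 0 / 3 + x 1 + x 2 / 2],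
      ![x 0 / 3 + x 1 + x 2 / 2, x 0 / 3, x 0 / 3 + x 2 / 2]] i := by
  rw [F, outerCorner_eq, outerMid_eq, center_eq]
  fin_cases i <;> ext j <;> fin_cases j <;>
    simp [mid_eq, corner, fin3_one_add_one, fin3_two_add_one, div_eq_mul_inv]

/-- The maps `F i` are linear in barycentric coordinates. -/
noncomputable def cellLin (i : Fin 6) : Pt →ₗ[ℝ] Pt where
  toFun := F i
  map_add' x y := by
    simp only [F, Pi.add_apply, add_smul]
    abel
  map_smul' c x := by
    simp only [F, Pi.smul_apply, smul_eq_mul, mul_smul, smul_add, RingHom.id_apply]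

@[simp] theorem cellLin_apply (i : Fin 6) (x : Pt) : cellLin i x = F i x := rfl

theorem F_injective (i : Fin 6) : Function.Injective (F i) := fun x y h => by
  rw [F_eq, F_eq] at h
  have h0 := congrFun h 0
  have h1 := congrFun h 1
  have h2 := congrFun h 2
  clear h
  have : x 0 = y 0 ∧ x 1 = y 1 ∧ x 2 = y 2 := by
    fin_cases i <;> simp at h0 h1 h2 <;> refine ⟨?_, ?_, ?_⟩ <;> linarith
  ext j
  fin_cases j
  · exact this.1
  · exact this.2.1
  · exact this.2.2

theorem F_corner_zero (i : Fin 6) : F i (corner 0) = center := by simp [F, corner]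

theorem F_corner_one (i : Fin 6) : F i (corner 1) = outerCorner i := by simp [F, corner]

theorem F_corner_two (i : Fin 6) : F i (corner 2) = outerMid i := by simp [F, corner]

/-- The triangle. -/
abbrev Tri : Set Pt := stdSimplex ℝ (Fin 3)

theorem mem_tri {x : Pt} : x ∈ Tri ↔ 0 ≤ x 0 ∧ 0 ≤ x 1 ∧ 0 ≤ x 2 ∧ x 0 + x 1 + x 2 = 1 := by
  simp [stdSimplex, Fin.forall_fin_succ, Fin.sum_univ_three, and_assoc]

theorem F_mem_tri (i : Fin 6) {x : Pt} (hx : x ∈ Tri) : F i x ∈ Tri := by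
  rw [mem_tri] at hx ⊢
  obtain ⟨h0, h1, h2, h⟩ := hx
  rw [F_eq]
  fin_cases i <;> simp <;> refine ⟨?_, ?_, ?_, ?_⟩ <;> linarith

theorem min_max_F (i : Fin 6) {x : Pt} (hx : x ∈ Tri) :
    min (min (F i x 0) (F i x 1)) (F i x 2) = x 0 / 3 ∧
    max (max (F i x 0) (F i x 1)) (F i x 2) = x 0 / 3 + x 1 + x 2 / 2 := by
  rw [mem_tri] at hx
  obtain ⟨h0, h1, h2, h⟩ := hx
  rw [F_eq]
  have a1 : x 0 / 3 ≤ x 0 / 3 + x 2 / 2 := by linarith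
  have a2 : x 0 / 3 + x 2 / 2 ≤ x 0 / 3 + x 1 + x 2 / 2 := by linarith
  have a3 := a1.trans a2
  clear h0 h1 h2 h
  generalize x 0 / 3 + x 1 + x 2 / 2 = c at *
  generalize x 0 / 3 + x 2 / 2 = b at *
  generalize x 0 / 3 = a at *
  fin_cases i <;> simp [a1, a2, a3]

/-- The six cell maps have a common left inverse on the triangle, the folding map, because the
smallest and the largest coordinate of `F i x` determine `x`. -/
theorem eq_of_F_eq_F {i j : Fin 6} {x y : Pt} (hx : x ∈ Tri) (hy : y ∈ Tri)
    (h : F i x = F j y) : x = y := by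
  have h1 := min_max_F i hx
  have h2 := min_max_F j hy
  rw [h] at h1
  have e1 := h1.1.symm.trans h2.1
  have e2 := h1.2.symm.trans h2.2
  have e3 := (mem_tri.1 hx).2.2.2
  have e4 := (mem_tri.1 hy).2.2.2
  ext k
  fin_cases k <;> simp <;> linarith

/-- Two cells are equal, or they are the cells `2k` and `2k+1` and meet in the side `x₁ = 0`, or
they are the cells `2k+1` and `2k+2` and meet in the side `x₂ = 0`, or they meet in the
center only. -/
theorem cells_inter {i j : Fin 6} {x : Pt} (hx : x ∈ Tri) (h : F i x = F j x) :
    i = j ∨ (x 1 = 0 ∧ ∃ k, (i = evenCell k ∧ j = oddCell k) ∨ (j = evenCell k ∧ i = oddCell k)) ∨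
      (x 2 = 0 ∧ ∃ k, (i = oddCell k ∧ j = evenCell (k + 1)) ∨
        (j = oddCell k ∧ i = evenCell (k + 1))) ∨ (x 1 = 0 ∧ x 2 = 0) := by
  by_cases hij : i = j
  · exact Or.inl hij
  right
  by_cases h1 : ∃ k, (i = evenCell k ∧ j = oddCell k) ∨ (j = evenCell k ∧ i = oddCell k)
  · refine Or.inl ⟨?_, h1⟩
    obtain ⟨k, ⟨rfl, rfl⟩ | ⟨rfl, rfl⟩⟩ := h1 <;> rw [F_eq, F_eq] at h <;>
    · have h0 := congrFun h 0
      have h1 := congrFun h 1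
      have h2 := congrFun h 2
      clear h
      fin_cases k <;> simp [evenCell, oddCell, Fin.ofNat] at h0 h1 h2 <;> linarith
  by_cases h2 : ∃ k, (i = oddCell k ∧ j = evenCell (k + 1)) ∨
      (j = oddCell k ∧ i = evenCell (k + 1))
  · refine Or.inr (Or.inl ⟨?_, h2⟩)
    obtain ⟨k, ⟨rfl, rfl⟩ | ⟨rfl, rfl⟩⟩ := h2 <;> rw [F_eq, F_eq] at h <;>
    · have h0 := congrFun h 0
      have h1 := congrFun h 1
      have h2 := congrFun h 2
      clear h
      fin_cases k <;> simp [evenCell, oddCell, Fin.ofNat] at h0 h1 h2 <;> linarith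
  refine Or.inr (Or.inr ?_)
  obtain ⟨-, p1, p2, -⟩ := mem_tri.1 hx
  rw [F_eq, F_eq] at h
  have a0 := congrFun h 0
  have a1 := congrFun h 1
  have a2 := congrFun h 2
  clear h
  revert hij h1 h2
  fin_cases i <;> fin_cases j <;> intro hij h1 h2 <;> first
    | exact absurd rfl hij
    | exact absurd (by decide) h1
    | exact absurd (by decide) h2
    | simp only [Matrix.cons_val, Fin.mk_zero, Fin.mk_one, Fin.reduceFinMk] at a0 a1 a2
      constructor <;> linarith

theorem F_even_eq_F_odd {k : Fin 3} {x : Pt} (h : x 1 = 0) :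
    F (evenCell k) x = F (oddCell k) x := by
  rw [F_eq, F_eq]
  fin_cases k <;> ext j <;> fin_cases j <;> simp [evenCell, oddCell, Fin.ofNat, h]

theorem F_odd_eq_F_even {k : Fin 3} {x : Pt} (h : x 2 = 0) :
    F (oddCell k) x = F (evenCell (k + 1)) x := by
  rw [F_eq, F_eq]
  fin_cases k <;> ext j <;> fin_cases j <;> simp [evenCell, oddCell, Fin.ofNat, h]

theorem eq_of_forall_F_eq_F {i j : Fin 6} (h : ∀ x, F i x = F j x) : i = j := by
  have hx : (fun _ => 1 / 3 : Pt) ∈ Tri := by rw [mem_tri]; norm_num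
  rcases cells_inter hx (h _) with h | ⟨h, -⟩ | ⟨h, -⟩ | ⟨h, -⟩
  · exact h
  all_goals norm_num at h

/-! ### Segments -/

theorem mem_segment_corner {x : Pt} {k : Fin 3} :
    x ∈ segment ℝ (corner k) (corner (k + 1)) ↔ x ∈ Tri ∧ x (k + 2) = 0 := by
  rw [mem_tri]
  constructor
  · rintro ⟨a, b, ha, hb, hab, rfl⟩
    fin_cases k <;> simp [corner, ha, hb, fin3_one_add_one, fin3_one_add_two,
      fin3_two_add_one, fin3_two_add_two] <;> linarith
  · rintro ⟨⟨h0, h1, h2, h⟩, hk⟩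
    fin_cases k
    · refine ⟨x 0, x 1, h0, h1, by simp at hk; linarith, ?_⟩
      simp at hk
      ext j
      fin_cases j <;> simp [corner, hk]
    · refine ⟨x 1, x 2, h1, h2, by simp at hk; linarith, ?_⟩
      simp at hk
      ext j
      fin_cases j <;> simp [corner, fin3_one_add_one, hk]
    · refine ⟨x 2, x 0, h2, h0, by simp at hk; linarith, ?_⟩
      simp at hk
      ext j
      fin_cases j <;> simp [corner, fin3_two_add_one, hk]

theorem image_F_segment (i : Fin 6) (a b : Pt) :
    F i '' segment ℝ a b = segment ℝ (F i a) (F i b) :=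
  image_segment ℝ (cellLin i).toAffineMap a b

theorem F_mem_segment {i : Fin 6} {x a b : Pt} :
    F i x ∈ segment ℝ (F i a) (F i b) ↔ x ∈ segment ℝ a b := by
  rw [← image_F_segment, (F_injective i).mem_set_image]

theorem inSegment_image {i : Fin 6} {s : Finset Pt} {a b : Pt} :
    InSegment (s.image (F i)) (F i a) (F i b) ↔ InSegment s a b := by
  simp only [InSegment, Finset.forall_mem_image, F_mem_segment]

theorem corner_mem_tri (i : Fin 3) : corner i ∈ Tri := by
  rw [mem_tri]
  fin_cases i <;> simp [corner]

theorem Fword_mem_tri (w : List (Fin 6)) {x : Pt} (hx : x ∈ Tri) : Fword w x ∈ Tri := by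
  induction w with
  | nil => exact hx
  | cons i w ih => exact F_mem_tri i ih

theorem segment_subset_tri {a b : Pt} (ha : a ∈ Tri) (hb : b ∈ Tri) : segment ℝ a b ⊆ Tri :=
  (convex_stdSimplex ℝ (Fin 3)).segment_subset ha hb

/-- The cells `2k` and `2k+1` meet the side `k` in their own side `x₀ = 0`; any other cell meets it
at most in its corner `x₀ = x₂ = 0`. -/
theorem F_apply_eq_zero {i : Fin 6} {k : Fin 3} {x : Pt} (hx : x ∈ Tri)
    (h : F i x (k + 2) = 0) : x 0 = 0 ∧ (i = evenCell k ∨ i = oddCell k ∨ x 2 = 0) := by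
  rw [mem_tri] at hx
  obtain ⟨h0, h1, h2, hs⟩ := hx
  rw [F_eq] at h
  by_cases hi : i = evenCell k
  · refine ⟨?_, Or.inl hi⟩
    subst hi
    fin_cases k <;> simp [evenCell, Fin.ofNat, fin3_one_add_two, fin3_two_add_two] at h <;> linarith
  by_cases hi' : i = oddCell k
  · refine ⟨?_, Or.inr (Or.inl hi')⟩
    subst hi'
    fin_cases k <;> simp [oddCell, Fin.ofNat, fin3_one_add_two, fin3_two_add_two] at h <;> linarith
  revert hi hi'
  fin_cases k <;> fin_cases i <;> intro hi hi' <;> first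
    | exact absurd rfl hi
    | exact absurd rfl hi'
    | simp [fin3_one_add_two, fin3_two_add_two] at h
      refine ⟨by linarith, Or.inr (Or.inr ?_)⟩
      linarith

theorem F_apply_of_zero {k : Fin 3} {x : Pt} (h : x 0 = 0) :
    F (evenCell k) x (k + 2) = 0 ∧ F (oddCell k) x (k + 2) = 0 := by
  rw [F_eq, F_eq]
  fin_cases k <;> simp [evenCell, oddCell, Fin.ofNat, fin3_one_add_two, fin3_two_add_two, h]

/-! ### Self-similarity of the subdivisions -/

theorem bary_image (i : Fin 6) (s : Finset Pt) : bary (s.image (F i)) = F i (bary s) := by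
  rw [bary, bary, Finset.card_image_of_injective _ (F_injective i),
    Finset.sum_image (F_injective i).injOn]
  change _ = cellLin i _
  rw [map_smul, map_sum]
  rfl

theorem mem_powersetCard_image {i : Fin 6} {n : ℕ} {s e : Finset Pt} :
    e ∈ (s.image (F i)).powersetCard n ↔ ∃ d ∈ s.powersetCard n, d.image (F i) = e := by
  simp only [Finset.mem_powersetCard]
  constructor
  · rintro ⟨h, hc⟩
    obtain ⟨d, hd, rfl⟩ := Finset.subset_image_iff.1 h
    rw [Finset.card_image_of_injective _ (F_injective i)] at hc
    exact ⟨d, ⟨by exact_mod_cast hd, hc⟩, rfl⟩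
  · rintro ⟨d, ⟨h, hc⟩, rfl⟩
    exact ⟨Finset.image_subset_image h,
      (Finset.card_image_of_injective _ (F_injective i)).trans hc⟩

/-- `K` consists of the images of `L` under the six cell maps. -/
structure IsUnionOfCells (K L : TriComplex) : Prop where
  verts : ∀ q, q ∈ K.verts ↔ ∃ i, ∃ p ∈ L.verts, F i p = q
  edges : ∀ e, e ∈ K.edges ↔ ∃ i, ∃ d ∈ L.edges, d.image (F i) = e
  tris : ∀ t, t ∈ K.tris ↔ ∃ i, ∃ s ∈ L.tris, s.image (F i) = t

/-- Subdivision commutes with the cell maps because they are affine and injective. -/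
theorem IsUnionOfCells.subdivide {K L : TriComplex} (h : IsUnionOfCells K L) :
    IsUnionOfCells (subdivide K) (subdivide L) where
  verts q := by
    simp only [Hexacarpet.subdivide, Finset.mem_union, Finset.mem_image, h.verts, h.edges, h.tris]
    constructor
    · rintro ((⟨i, p, hp, rfl⟩ | ⟨_, ⟨i, d, hd, rfl⟩, rfl⟩) | ⟨_, ⟨i, d, hd, rfl⟩, rfl⟩)
      · exact ⟨i, p, Or.inl (Or.inl hp), rfl⟩
      · exact ⟨i, _, Or.inl (Or.inr ⟨d, hd, rfl⟩), (bary_image i d).symm⟩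
      · exact ⟨i, _, Or.inr ⟨d, hd, rfl⟩, (bary_image i d).symm⟩
    · rintro ⟨i, _, (hp | ⟨d, hd, rfl⟩) | ⟨d, hd, rfl⟩, rfl⟩
      · exact Or.inl (Or.inl ⟨i, _, hp, rfl⟩)
      · exact Or.inl (Or.inr ⟨_, ⟨i, d, hd, rfl⟩, bary_image i d⟩)
      · exact Or.inr ⟨_, ⟨i, d, hd, rfl⟩, bary_image i d⟩
  edges e := by
    simp only [Hexacarpet.subdivide, Finset.mem_union, Finset.mem_biUnion, Finset.mem_image,
      h.edges, h.tris]
    constructor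
    · rintro ((⟨_, ⟨i, d, hd, rfl⟩, q, hq, rfl⟩ | ⟨_, ⟨i, d, hd, rfl⟩, q, hq, rfl⟩) |
        ⟨_, ⟨i, d, hd, rfl⟩, q, hq, rfl⟩)
      · obtain ⟨q, hq', rfl⟩ := Finset.mem_image.1 hq
        exact ⟨i, _, Or.inl (Or.inl ⟨d, hd, q, hq', rfl⟩), by
          simp [bary_image, Finset.image_insert]⟩
      · obtain ⟨q, hq', rfl⟩ := Finset.mem_image.1 hq
        exact ⟨i, _, Or.inl (Or.inr ⟨d, hd, q, hq', rfl⟩), by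
          simp [bary_image, Finset.image_insert]⟩
      · obtain ⟨q, hq', rfl⟩ := mem_powersetCard_image.1 hq
        exact ⟨i, _, Or.inr ⟨d, hd, q, hq', rfl⟩, by simp [bary_image, Finset.image_insert]⟩
    · rintro ⟨i, _, (⟨d, hd, q, hq, rfl⟩ | ⟨d, hd, q, hq, rfl⟩) | ⟨d, hd, q, hq, rfl⟩, rfl⟩
      · exact Or.inl (Or.inl ⟨_, ⟨i, d, hd, rfl⟩, F i q, Finset.mem_image_of_mem _ hq, by
          simp [bary_image, Finset.image_insert]⟩)
      · exact Or.inl (Or.inr ⟨_, ⟨i, d, hd, rfl⟩, F i q, Finset.mem_image_of_mem _ hq, by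
          simp [bary_image, Finset.image_insert]⟩)
      · exact Or.inr ⟨_, ⟨i, d, hd, rfl⟩, _, mem_powersetCard_image.2 ⟨q, hq, rfl⟩, by
          simp [bary_image, Finset.image_insert]⟩
  tris t := by
    simp only [Hexacarpet.subdivide, Finset.mem_biUnion, Finset.mem_image, h.tris]
    constructor
    · rintro ⟨_, ⟨i, d, hd, rfl⟩, e, he, q, hq, rfl⟩
      obtain ⟨e, he', rfl⟩ := mem_powersetCard_image.1 he
      obtain ⟨q, hq', rfl⟩ := Finset.mem_image.1 hq
      exact ⟨i, _, ⟨d, hd, e, he', q, hq', rfl⟩, by simp [bary_image, Finset.image_insert]⟩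
    · rintro ⟨i, _, ⟨d, hd, e, he, q, hq, rfl⟩, rfl⟩
      exact ⟨_, ⟨i, d, hd, rfl⟩, _, mem_powersetCard_image.2 ⟨e, he, rfl⟩, F i q,
        Finset.mem_image_of_mem _ hq, by simp [bary_image, Finset.image_insert]⟩

theorem powersetCard_two_corners :
    Finset.powersetCard 2 ({corner 0, corner 1, corner 2} : Finset Pt) =
      {{corner 0, corner 1}, {corner 1, corner 2}, {corner 2, corner 0}} := by
  have h01 : corner 0 ≠ corner 1 := corner_ne (by decide)
  have h12 : corner 1 ≠ corner 2 := corner_ne (by decide)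
  have h20 : corner 2 ≠ corner 0 := corner_ne (by decide)
  ext e
  simp only [Finset.mem_powersetCard, Finset.mem_insert, Finset.mem_singleton]
  constructor
  · rintro ⟨h, hc⟩
    obtain ⟨a, b, hab, rfl⟩ := Finset.card_eq_two.1 hc
    have ha := h (Finset.mem_insert_self a _)
    have hb := h (Finset.mem_insert_of_mem (Finset.mem_singleton_self b))
    simp only [Finset.mem_insert, Finset.mem_singleton] at ha hb
    rcases ha with rfl | rfl | rfl <;> rcases hb with rfl | rfl | rfl <;>
      simp_all [Finset.pair_comm]
  · rintro (rfl | rfl | rfl)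
    · exact ⟨by simp [Finset.subset_iff], Finset.card_pair h01⟩
    · exact ⟨by simp [Finset.subset_iff], Finset.card_pair h12⟩
    · exact ⟨by simp [Finset.subset_iff], Finset.card_pair h20⟩

theorem isUnionOfCells_zero : IsUnionOfCells (T 1) (T 0) := by
  have m0 : bary {corner 0, corner 1} = mid 0 := rfl
  have m1 : bary {corner 1, corner 2} = mid 1 := rfl
  have m2 : bary {corner 2, corner 0} = mid 2 := rfl
  have c : bary {corner 0, corner 1, corner 2} = center := rfl
  constructor
  · intro q
    simp [T, subdivide, F_corner_zero, F_corner_one, F_corner_two, Fin.exists_fin_succ,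
      outerCorner_eq, outerMid_eq, m0, m1, m2, c]
    tauto
  · intro e
    simp [T, subdivide, F_corner_zero, F_corner_one, F_corner_two, Fin.exists_fin_succ,
      outerCorner_eq, outerMid_eq, m0, m1, m2, c, powersetCard_two_corners, Finset.image_insert,
      eq_comm (b := e)]
    rw [Finset.pair_comm center (corner 0), Finset.pair_comm center (corner 1),
      Finset.pair_comm center (corner 2)]
    tauto
  · intro e
    simp [T, subdivide, F_corner_zero, F_corner_one, F_corner_two, Fin.exists_fin_succ,
      outerCorner_eq, outerMid_eq, m0, m1, m2, c, powersetCard_two_corners, Finset.image_insert,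
      eq_comm (b := e)]
    have rot : ∀ a b : Pt, ({center, a, b} : Finset Pt) = {a, b, center} := fun a b => by
      rw [Finset.insert_comm, Finset.pair_comm]
    simp only [rot]
    tauto

theorem isUnionOfCells_T (n : ℕ) : IsUnionOfCells (T (n + 1)) (T n) := by
  induction n with
  | zero => exact isUnionOfCells_zero
  | succ n ih => exact ih.subdivide

theorem verts_subset_tri {n : ℕ} {q : Pt} (hq : q ∈ (T n).verts) : q ∈ Tri := by
  induction n generalizing q with
  | zero =>
    simp only [T, Finset.mem_insert, Finset.mem_singleton] at hq
    rcases hq with rfl | rfl | rfl <;> exact corner_mem_tri _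
  | succ n ih =>
    obtain ⟨i, p, hp, rfl⟩ := ((isUnionOfCells_T n).verts q).1 hq
    exact F_mem_tri i (ih hp)

theorem card_of_mem_edges {n : ℕ} {e : Finset Pt} (he : e ∈ (T n).edges) : e.card = 2 := by
  induction n generalizing e with
  | zero =>
    simp only [T, Finset.mem_insert, Finset.mem_singleton] at he
    rcases he with rfl | rfl | rfl <;> exact Finset.card_pair (corner_ne (by decide))
  | succ n ih =>
    obtain ⟨i, d, hd, rfl⟩ := ((isUnionOfCells_T n).edges e).1 he
    exact (Finset.card_image_of_injective _ (F_injective i)).trans (ih hd)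

theorem card_of_mem_tris {n : ℕ} {t : Finset Pt} (ht : t ∈ (T n).tris) : t.card = 3 := by
  induction n generalizing t with
  | zero =>
    simp only [T, Finset.mem_singleton] at ht
    exact Finset.card_eq_three.2 ⟨_, _, _, corner_ne (by decide), corner_ne (by decide),
      corner_ne (by decide), ht⟩
  | succ n ih =>
    obtain ⟨i, d, hd, rfl⟩ := ((isUnionOfCells_T n).tris t).1 ht
    exact (Finset.card_image_of_injective _ (F_injective i)).trans (ih hd)

theorem subset_verts_of_mem_edges {n : ℕ} {e : Finset Pt} (he : e ∈ (T n).edges) :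
    e ⊆ (T n).verts := by
  induction n generalizing e with
  | zero =>
    simp only [T, Finset.mem_insert, Finset.mem_singleton] at he
    rcases he with rfl | rfl | rfl <;> simp [T, Finset.subset_iff]
  | succ n ih =>
    obtain ⟨i, d, hd, rfl⟩ := ((isUnionOfCells_T n).edges e).1 he
    intro q hq
    obtain ⟨p, hp, rfl⟩ := Finset.mem_image.1 hq
    exact ((isUnionOfCells_T n).verts _).2 ⟨i, p, ih hd hp, rfl⟩

theorem subset_verts_of_mem_tris {n : ℕ} {t : Finset Pt} (ht : t ∈ (T n).tris) :
    t ⊆ (T n).verts := by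
  induction n generalizing t with
  | zero =>
    simp only [T, Finset.mem_singleton] at ht
    rw [ht, T]
  | succ n ih =>
    obtain ⟨i, d, hd, rfl⟩ := ((isUnionOfCells_T n).tris t).1 ht
    intro q hq
    obtain ⟨p, hp, rfl⟩ := Finset.mem_image.1 hq
    exact ((isUnionOfCells_T n).verts _).2 ⟨i, p, ih hd hp, rfl⟩

theorem pair_mem_edges {n : ℕ} {t : Finset Pt} (ht : t ∈ (T n).tris) {p q : Pt} (hp : p ∈ t)
    (hq : q ∈ t) (hpq : p ≠ q) : {p, q} ∈ (T n).edges := by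
  induction n generalizing t p q with
  | zero =>
    simp only [T, Finset.mem_singleton] at ht
    subst ht
    have : {p, q} ∈ Finset.powersetCard 2 ({corner 0, corner 1, corner 2} : Finset Pt) :=
      Finset.mem_powersetCard.2 ⟨Finset.insert_subset hp (Finset.singleton_subset_iff.2 hq),
        Finset.card_pair hpq⟩
    rwa [powersetCard_two_corners] at this
  | succ n ih =>
    obtain ⟨i, d, hd, rfl⟩ := ((isUnionOfCells_T n).tris t).1 ht
    obtain ⟨p, hp', rfl⟩ := Finset.mem_image.1 hp
    obtain ⟨q, hq', rfl⟩ := Finset.mem_image.1 hq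
    exact ((isUnionOfCells_T n).edges _).2
      ⟨i, _, ih hd hp' hq' fun h => hpq (congrArg _ h), by simp [Finset.image_insert]⟩

/-- The triangles are nondegenerate: in barycentric coordinates, their vertices form a basis. -/
theorem span_of_mem_tris {n : ℕ} {t : Finset Pt} (ht : t ∈ (T n).tris) :
    Submodule.span ℝ (t : Set Pt) = ⊤ := by
  induction n generalizing t with
  | zero =>
    simp only [T, Finset.mem_singleton] at ht
    rw [eq_top_iff]
    intro x _
    have hx : x = x 0 • corner 0 + x 1 • corner 1 + x 2 • corner 2 := by
      ext j
      fin_cases j <;> simp [corner]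
    have hm : ∀ k, corner k ∈ Submodule.span ℝ (t : Set Pt) := fun k => by
      refine Submodule.subset_span ?_
      rw [ht]
      fin_cases k <;> simp
    rw [hx]
    exact add_mem (add_mem (Submodule.smul_mem _ _ (hm 0)) (Submodule.smul_mem _ _ (hm 1)))
      (Submodule.smul_mem _ _ (hm 2))
  | succ n ih =>
    obtain ⟨i, d, hd, rfl⟩ := ((isUnionOfCells_T n).tris t).1 ht
    have hs : LinearMap.range (cellLin i) = ⊤ :=
      LinearMap.range_eq_top.2 (LinearMap.injective_iff_surjective.1 (F_injective i))
    rw [Finset.coe_image, show F i = ⇑(cellLin i) from rfl, ← Submodule.map_span, ih hd,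
      Submodule.map_top, hs]

/-- If a simplex of the cell `i` is also a simplex of the cell `j`, then it is the image of the
same simplex under both cell maps, and these agree on it. -/
theorem image_F_eq_image_F {i j : Fin 6} {s s' : Finset Pt} (hs : ∀ p ∈ s, p ∈ Tri)
    (hs' : ∀ p ∈ s', p ∈ Tri) (h : s.image (F i) = s'.image (F j)) :
    s = s' ∧ ∀ p ∈ s, F i p = F j p := by
  have key : ∀ {i j : Fin 6} {s s' : Finset Pt}, (∀ p ∈ s, p ∈ Tri) → (∀ p ∈ s', p ∈ Tri) →
      s.image (F i) = s'.image (F j) → ∀ p ∈ s, p ∈ s' ∧ F i p = F j p := by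
    intro i j s s' hs hs' h p hp
    have hm : F i p ∈ s'.image (F j) := h ▸ Finset.mem_image_of_mem _ hp
    obtain ⟨q, hq, e⟩ := Finset.mem_image.1 hm
    obtain rfl := eq_of_F_eq_F (hs' q hq) (hs p hp) e
    exact ⟨hq, e.symm⟩
  refine ⟨Finset.Subset.antisymm (fun p hp => (key hs hs' h p hp).1)
    fun p hp => (key hs' hs h.symm p hp).1, fun p hp => (key hs hs' h p hp).2⟩

/-- Two distinct points of the triangle do not both lie on two different sides. -/
theorem eq_corner_of_eq_zero {p q : Pt} (hp : p ∈ Tri) (hq : q ∈ Tri) {j k : Fin 3} (hjk : j ≠ k)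
    (hpj : p j = 0) (hpk : p k = 0) (hqj : q j = 0) (hqk : q k = 0) : p = q := by
  obtain ⟨-, -, -, h⟩ := mem_tri.1 hp
  obtain ⟨-, -, -, h'⟩ := mem_tri.1 hq
  ext l
  fin_cases j <;> fin_cases k <;> first
    | exact absurd rfl hjk
    | fin_cases l <;> simp_all

theorem not_even_odd_and_odd_even : ∀ i j : Fin 6,
    (∃ k, (i = evenCell k ∧ j = oddCell k) ∨ (j = evenCell k ∧ i = oddCell k)) →
    ¬∃ k, (i = oddCell k ∧ j = evenCell (k + 1)) ∨ (j = oddCell k ∧ i = evenCell (k + 1)) := by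
  decide

/-- A simplex with at least two vertices which lies in two different cells lies in a common side of
two neighbouring cells. -/
theorem cells_inter_simplex {i j : Fin 6} {s : Finset Pt} (hs : ∀ p ∈ s, p ∈ Tri)
    (hc : 1 < s.card) (h : ∀ p ∈ s, F i p = F j p) (hij : i ≠ j) :
    ((∀ p ∈ s, p 1 = 0) ∧
      ∃ k, (i = evenCell k ∧ j = oddCell k) ∨ (j = evenCell k ∧ i = oddCell k)) ∨
    ((∀ p ∈ s, p 2 = 0) ∧
      ∃ k, (i = oddCell k ∧ j = evenCell (k + 1)) ∨ (j = oddCell k ∧ i = evenCell (k + 1))) := by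
  by_cases h1 : ∃ k, (i = evenCell k ∧ j = oddCell k) ∨ (j = evenCell k ∧ i = oddCell k)
  · refine Or.inl ⟨fun p hp => ?_, h1⟩
    rcases cells_inter (hs p hp) (h p hp) with h | ⟨h, -⟩ | ⟨-, h⟩ | ⟨h, -⟩
    · exact absurd h hij
    · exact h
    · exact absurd h (not_even_odd_and_odd_even i j h1)
    · exact h
  by_cases h2 : ∃ k, (i = oddCell k ∧ j = evenCell (k + 1)) ∨
      (j = oddCell k ∧ i = evenCell (k + 1))
  · refine Or.inr ⟨fun p hp => ?_, h2⟩
    rcases cells_inter (hs p hp) (h p hp) with h | ⟨-, h⟩ | ⟨h, -⟩ | ⟨-, h⟩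
    · exact absurd h hij
    · exact absurd h h1
    · exact h
    · exact h
  exfalso
  have key : ∀ p ∈ s, p 1 = 0 ∧ p 2 = 0 := fun p hp => by
    rcases cells_inter (hs p hp) (h p hp) with h | ⟨-, h⟩ | ⟨-, h⟩ | h
    · exact absurd h hij
    · exact absurd h h1
    · exact absurd h h2
    · exact h
  obtain ⟨p, hp, q, hq, hpq⟩ := Finset.one_lt_card.1 hc
  exact hpq (eq_corner_of_eq_zero (hs p hp) (hs q hq) (by decide : (1 : Fin 3) ≠ 2) (key p hp).1
    (key p hp).2 (key q hq).1 (key q hq).2)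

/-- A simplex with at least two vertices lies in a side of the triangle only if its cell has a side
contained in this side. -/
theorem simplex_subset_side {i : Fin 6} {k : Fin 3} {s : Finset Pt} (hs : ∀ p ∈ s, p ∈ Tri)
    (hc : 1 < s.card) (h : ∀ p ∈ s, F i p (k + 2) = 0) :
    (∀ p ∈ s, p 0 = 0) ∧ (i = evenCell k ∨ i = oddCell k) := by
  have h0 : ∀ p ∈ s, p 0 = 0 := fun p hp => (F_apply_eq_zero (hs p hp) (h p hp)).1
  refine ⟨h0, ?_⟩
  by_contra! hi
  have h2 : ∀ p ∈ s, p 2 = 0 := fun p hp => by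
    simpa [hi] using (F_apply_eq_zero (hs p hp) (h p hp)).2
  obtain ⟨p, hp, q, hq, hpq⟩ := Finset.one_lt_card.1 hc
  exact hpq (eq_corner_of_eq_zero (hs p hp) (hs q hq) (by decide : (0 : Fin 3) ≠ 2) (h0 p hp)
    (h2 p hp) (h0 q hq) (h2 q hq))

/-- Two cells with a common triangle are equal. -/
theorem eq_of_F_eq_F_on_tri {n : ℕ} {i j : Fin 6} {t : Finset Pt} (ht : t ∈ (T n).tris)
    (h : ∀ p ∈ t, F i p = F j p) : i = j :=
  eq_of_forall_F_eq_F fun x => LinearMap.congr_fun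
    (LinearMap.ext_on (f := cellLin i) (g := cellLin j) (span_of_mem_tris ht) h) x

/-! ### Self-similarity of the hexacarpet graphs -/

theorem VH.card_pos {n : ℕ} (x : VH n) : 1 < x.1.card := by
  rcases Finset.mem_union.1 x.2 with h | h
  · rw [card_of_mem_edges h]; norm_num
  · rw [card_of_mem_tris h]; norm_num

theorem VH.mem_tri {n : ℕ} (x : VH n) {p : Pt} (hp : p ∈ x.1) : p ∈ Tri := by
  rcases Finset.mem_union.1 x.2 with h | h
  · exact verts_subset_tri (subset_verts_of_mem_edges h hp)
  · exact verts_subset_tri (subset_verts_of_mem_tris h hp)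

theorem VH.mem_edges_iff {n : ℕ} (x : VH n) : x.1 ∈ (T n).edges ↔ x.1.card = 2 := by
  refine ⟨card_of_mem_edges, fun h => (Finset.mem_union.1 x.2).resolve_right fun ht => ?_⟩
  rw [card_of_mem_tris ht] at h
  norm_num at h

theorem VH.mem_tris_iff {n : ℕ} (x : VH n) : x.1 ∈ (T n).tris ↔ x.1.card = 3 := by
  refine ⟨card_of_mem_tris, fun h => (Finset.mem_union.1 x.2).resolve_left fun he => ?_⟩
  rw [card_of_mem_edges he] at h
  norm_num at h

/-- The embedding of `G^H_n` in `G^H_{n+1}` as the cell `i`. -/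
noncomputable def cellMap (n : ℕ) (i : Fin 6) (x : VH n) : VH (n + 1) :=
  ⟨x.1.image (F i), by
    rcases Finset.mem_union.1 x.2 with h | h
    · exact Finset.mem_union_left _ (((isUnionOfCells_T n).edges _).2 ⟨i, _, h, rfl⟩)
    · exact Finset.mem_union_right _ (((isUnionOfCells_T n).tris _).2 ⟨i, _, h, rfl⟩)⟩

theorem exists_cellMap_eq {n : ℕ} (x : VH (n + 1)) : ∃ i y, cellMap n i y = x := by
  rcases Finset.mem_union.1 x.2 with h | h
  · obtain ⟨i, d, hd, e⟩ := ((isUnionOfCells_T n).edges _).1 h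
    exact ⟨i, ⟨d, Finset.mem_union_left _ hd⟩, Subtype.ext e⟩
  · obtain ⟨i, d, hd, e⟩ := ((isUnionOfCells_T n).tris _).1 h
    exact ⟨i, ⟨d, Finset.mem_union_right _ hd⟩, Subtype.ext e⟩

theorem cellMap_eq_cellMap {n : ℕ} {i j : Fin 6} {x y : VH n} (h : cellMap n i x = cellMap n j y) :
    x = y ∧ ∀ p ∈ x.1, F i p = F j p := by
  have := image_F_eq_image_F (fun p => x.mem_tri) (fun p => y.mem_tri) (congrArg Subtype.val h)
  exact ⟨Subtype.ext this.1, this.2⟩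

theorem cellMap_congr {n : ℕ} {i j : Fin 6} {x : VH n} (h : ∀ p ∈ x.1, F i p = F j p) :
    cellMap n i x = cellMap n j x :=
  Subtype.ext (Finset.image_congr fun p hp => h p hp)

theorem mem_sideH {n : ℕ} {k : Fin 3} {x : VH n} : x ∈ sideH n k ↔ ∀ p ∈ x.1, p (k + 2) = 0 := by
  refine forall₂_congr fun p hp => ?_
  rw [mem_segment_corner, and_iff_right (x.mem_tri hp)]

/-- The cells `2k` and `2k+1` meet in their sides `2`. -/
theorem cellMap_even_eq_odd {n : ℕ} {x : VH n} (hx : x ∈ sideH n 2) (k : Fin 3) :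
    cellMap n (evenCell k) x = cellMap n (oddCell k) x :=
  cellMap_congr fun p hp => F_even_eq_F_odd (mem_sideH.1 hx p hp)

/-- The cells `2k+1` and `2k+2` meet in their sides `0`. -/
theorem cellMap_odd_eq_even {n : ℕ} {x : VH n} (hx : x ∈ sideH n 0) (k : Fin 3) :
    cellMap n (oddCell k) x = cellMap n (evenCell (k + 1)) x :=
  cellMap_congr fun p hp => F_odd_eq_F_even (mem_sideH.1 hx p hp)

theorem cellMap_even_mem_sideH {n : ℕ} {x : VH n} (hx : x ∈ sideH n 1) (k : Fin 3) :
    cellMap n (evenCell k) x ∈ sideH (n + 1) k :=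
  mem_sideH.2 <| Finset.forall_mem_image.2 fun p hp => (F_apply_of_zero (mem_sideH.1 hx p hp)).1

theorem cellMap_odd_mem_sideH {n : ℕ} {x : VH n} (hx : x ∈ sideH n 1) (k : Fin 3) :
    cellMap n (oddCell k) x ∈ sideH (n + 1) k :=
  mem_sideH.2 <| Finset.forall_mem_image.2 fun p hp => (F_apply_of_zero (mem_sideH.1 hx p hp)).2

theorem cellMap_mem_sideH {n : ℕ} {i : Fin 6} {k : Fin 3} {x : VH n}
    (h : cellMap n i x ∈ sideH (n + 1) k) :
    x ∈ sideH n 1 ∧ (i = evenCell k ∨ i = oddCell k) := by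
  have := simplex_subset_side (fun p => x.mem_tri) x.card_pos
    (Finset.forall_mem_image.1 (mem_sideH.1 h))
  exact ⟨mem_sideH.2 this.1, this.2⟩

/-- The edge `[p_k, p_{k+1}]` of the undivided triangle. -/
noncomputable def sideEdge (k : Fin 3) : VH 0 :=
  ⟨{corner k, corner (k + 1)}, Finset.mem_union_left _ (by fin_cases k <;> simp [T])⟩

/-- The undivided triangle. -/
noncomputable def wholeTri : VH 0 :=
  ⟨{corner 0, corner 1, corner 2}, Finset.mem_union_right _ (by simp [T])⟩

theorem sideEdge_mem_sideH (k : Fin 3) : sideEdge k ∈ sideH 0 k := by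
  intro p hp
  simp only [sideEdge, Finset.mem_insert, Finset.mem_singleton] at hp
  rcases hp with rfl | rfl
  · exact left_mem_segment _ _ _
  · exact right_mem_segment _ _ _

theorem sideH_nonempty (n : ℕ) (k : Fin 3) : (sideH n k).Nonempty := by
  induction n generalizing k with
  | zero => exact ⟨_, sideEdge_mem_sideH k⟩
  | succ n ih =>
    obtain ⟨x, hx⟩ := ih 1
    exact ⟨_, cellMap_even_mem_sideH hx k⟩

/-- Adjacency in the hexacarpet graph. -/
def AdjH {n : ℕ} (x y : VH n) : Prop :=
  (x.1.card = 2 ∧ y.1.card = 3 ∧ x.1 ⊆ y.1) ∨ (y.1.card = 2 ∧ x.1.card = 3 ∧ y.1 ⊆ x.1)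

theorem condH_eq (κ : ℝ) {n : ℕ} (x y : VH n) [Decidable (AdjH x y)] :
    condH κ n x y = if AdjH x y then κ else 0 := by
  unfold condH
  congr 1
  simp only [VH.mem_edges_iff, VH.mem_tris_iff, AdjH]

theorem condH_nonneg {κ : ℝ} (hκ : 0 ≤ κ) {n : ℕ} (x y : VH n) : 0 ≤ condH κ n x y := by
  unfold condH
  split_ifs
  exacts [hκ, le_rfl]

theorem adjH_cellMap {n : ℕ} {i : Fin 6} {x y : VH n} :
    AdjH (cellMap n i x) (cellMap n i y) ↔ AdjH x y := by
  have hc : ∀ z : VH n, (cellMap n i z).1.card = z.1.card := fun z =>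
    Finset.card_image_of_injective _ (F_injective i)
  have hs : ∀ z w : VH n, (cellMap n i z).1 ⊆ (cellMap n i w).1 ↔ z.1 ⊆ w.1 := fun z w =>
    Finset.image_subset_image_iff (F_injective i)
  simp only [AdjH, hc, hs]

/-- An edge and a triangle which are adjacent lie in a common cell. -/
theorem exists_cell_of_subset {n : ℕ} {x y : VH (n + 1)} (h : x.1 ⊆ y.1) :
    ∃ i a b, cellMap n i a = x ∧ cellMap n i b = y := by
  obtain ⟨i, b, rfl⟩ := exists_cellMap_eq y
  obtain ⟨j, a, rfl⟩ := exists_cellMap_eq x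
  refine ⟨i, a, b, cellMap_congr fun p hp => ?_, rfl⟩
  obtain ⟨q, hq, e⟩ := Finset.mem_image.1 (h (Finset.mem_image_of_mem _ hp))
  obtain rfl := eq_of_F_eq_F (b.mem_tri hq) (a.mem_tri hp) e
  exact e

theorem AdjH.exists_cell {n : ℕ} {x y : VH (n + 1)} (h : AdjH x y) :
    ∃ i a b, cellMap n i a = x ∧ cellMap n i b = y := by
  rcases h with ⟨-, -, h⟩ | ⟨-, -, h⟩
  · exact exists_cell_of_subset h
  · obtain ⟨i, a, b, ha, hb⟩ := exists_cell_of_subset h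
    exact ⟨i, b, a, hb, ha⟩

/-- The conductances of `G^H_{n+1}` are those of six copies of `G^H_n`: each adjacent pair of an
edge and a triangle lies in exactly one cell. -/
theorem pushCond_cellMap (κ : ℝ) (n : ℕ) :
    pushCond (fun z : Fin 6 × VH n => cellMap n z.1 z.2) (copiesCond (condH κ n)) =
      condH κ (n + 1) := by
  classical
  ext x y
  rw [pushCond_eq_sum, condH_eq]
  split_ifs with h
  · obtain ⟨i, a, b, rfl, rfl⟩ := h.exists_cell
    rw [Finset.sum_eq_single ((i, a), (i, b))]
    · simp [copiesCond, condH_eq, adjH_cellMap.1 h]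
    · rintro ⟨⟨j, a'⟩, ⟨k, b'⟩⟩ - hne
      simp only [Prod.map, Prod.mk.injEq, copiesCond, ite_eq_right_iff]
      rintro ⟨ha, hb⟩ rfl
      obtain ⟨rfl, ha'⟩ := cellMap_eq_cellMap ha
      obtain ⟨rfl, hb'⟩ := cellMap_eq_cellMap hb
      refine absurd ?_ hne
      have hij : j = i := by
        rcases adjH_cellMap.1 h with ⟨-, h3, -⟩ | ⟨-, h3, -⟩
        · exact eq_of_F_eq_F_on_tri ((VH.mem_tris_iff _).2 h3) hb'
        · exact eq_of_F_eq_F_on_tri ((VH.mem_tris_iff _).2 h3) ha'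
      rw [hij]
    · simp
  · refine Finset.sum_eq_zero ?_
    rintro ⟨⟨i, a⟩, ⟨j, b⟩⟩ -
    simp only [Prod.map, Prod.mk.injEq, copiesCond, ite_eq_right_iff]
    rintro ⟨rfl, rfl⟩ rfl
    rw [condH_eq, if_neg fun h' => h (adjH_cellMap.2 h')]

theorem graphEnergy_condH_succ (κ : ℝ) (n : ℕ) (f : VH (n + 1) → ℝ) :
    graphEnergy (condH κ (n + 1)) f =
      ∑ i, graphEnergy (condH κ n) fun x => f (cellMap n i x) := by
  rw [← pushCond_cellMap, graphEnergy_pushCond, graphEnergy_copiesCond]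
  rfl

/-! ### The shorted hexacarpet graph is a gasket graph -/

theorem shortSetoid_of_sideH {n : ℕ} {k : Fin 3} {x y : VH n} (hx : x ∈ sideH n k)
    (hy : y ∈ sideH n k) : shortSetoid n x y :=
  Relation.EqvGen.rel _ _ ⟨[], k, hx, hy⟩

theorem shortSetoid_cellMap {n : ℕ} {x y : VH n} (h : shortSetoid n x y) (i : Fin 6) :
    shortSetoid (n + 1) (cellMap n i x) (cellMap n i y) := by
  change Relation.EqvGen _ _ _ at h
  induction h with
  | rel x y h =>
    obtain ⟨w, k, hx, hy⟩ := h
    exact Relation.EqvGen.rel _ _ ⟨i :: w, k, inSegment_image.2 hx, inSegment_image.2 hy⟩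
  | refl => exact (shortSetoid _).refl _
  | symm _ _ _ ih => exact (shortSetoid _).symm ih
  | trans _ _ _ _ _ ih ih' => exact (shortSetoid _).trans ih ih'

/-- A simplex in a side of a cell of any level is the image of a simplex of this cell. -/
theorem exists_cellMap_eq_of_inSegment {n : ℕ} {x : VH (n + 1)} {i : Fin 6} {a b : Pt}
    (ha : a ∈ Tri) (hb : b ∈ Tri) (h : InSegment x.1 (F i a) (F i b)) :
    ∃ y : VH n, cellMap n i y = x ∧ InSegment y.1 a b := by
  obtain ⟨j, y, rfl⟩ := exists_cellMap_eq x
  have key : ∀ p ∈ y.1, F j p = F i p := fun p hp => by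
    have hm := h _ (Finset.mem_image_of_mem _ hp)
    rw [← image_F_segment] at hm
    obtain ⟨q, hq, e⟩ := hm
    obtain rfl := eq_of_F_eq_F (segment_subset_tri ha hb hq) (y.mem_tri hp) e
    exact e.symm
  have e := cellMap_congr key
  refine ⟨y, e.symm, ?_⟩
  rw [e] at h
  exact inSegment_image.1 h

/-- A presentation of the gasket graph `Γ_n` as the hexacarpet graph with the classes of the
shorting relation identified, the sides of the triangle becoming the corners of `Γ_n`. -/
structure IsShorting (κ : ℝ) (n : ℕ) (π : VH n → (gasket κ n).V) : Prop where
  surj : Function.Surjective π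
  eq_iff : ∀ x y, π x = π y ↔ shortSetoid n x y
  cond : pushCond π (condH κ n) = (gasket κ n).cond
  cor : ∀ k, ∀ x ∈ sideH n k, π x = (gasket κ n).cor k

/-- The vertices of `G^H_0`, named by the vertices of the star `Γ_0`. -/
noncomputable def ofStar : Option (Fin 3) → VH 0
  | none => wholeTri
  | some k => sideEdge k

theorem ofStar_surjective : Function.Surjective ofStar := by
  rintro ⟨x, hx⟩
  simp only [T, Finset.mem_union, Finset.mem_insert, Finset.mem_singleton] at hx
  rcases hx with (rfl | rfl | rfl) | rfl
  · exact ⟨some 0, rfl⟩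
  · exact ⟨some 1, rfl⟩
  · exact ⟨some 2, rfl⟩
  · exact ⟨none, rfl⟩

theorem corner_apply_ne {j k : Fin 3} : corner j k ≠ 0 ↔ k = j := by
  simp [corner, Pi.single_apply]

theorem eq_sideEdge_of_mem_sideH {k : Fin 3} {x : VH 0} (hx : x ∈ sideH 0 k) :
    x = sideEdge k := by
  rw [mem_sideH] at hx
  have key : ∀ j, corner j ∈ x.1 → k + 2 ≠ j := fun j hj e =>
    corner_apply_ne.2 e (hx _ hj)
  obtain ⟨s, rfl⟩ := ofStar_surjective x
  rcases s with - | j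
  · have h : ∀ j, k + 2 ≠ j := fun j => key j (by fin_cases j <;> simp [ofStar, wholeTri])
    exact absurd rfl (h (k + 2))
  · have h0 := key j (by simp [ofStar, sideEdge])
    have h1 := key (j + 1) (by simp [ofStar, sideEdge])
    have : j = k := by
      revert h0 h1
      clear key hx
      revert j k
      decide
    rw [this]
    rfl

theorem ofStar_injective : Function.Injective ofStar := by
  have hc : ∀ s, (ofStar s).1.card = if s = none then 3 else 2 := by
    intro s
    cases s with
    | none => exact card_of_mem_tris (n := 0) (by simp [ofStar, wholeTri, T])
    | some k => exact Finset.card_pair (corner_ne (fin3_ne_add_one k))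
  intro s t h
  have h' := hc s
  rw [h, hc t] at h'
  cases s with
  | none =>
    cases t with
    | none => rfl
    | some k => simp at h'
  | some j =>
    cases t with
    | none => simp at h'
    | some k =>
      -- the edge `j` lies in the side `k` only if `j = k`
      have hj := mem_sideH.1 (sideEdge_mem_sideH j)
      rw [show sideEdge j = sideEdge k from h] at hj
      have e1 : j + 2 ≠ k := fun e => corner_apply_ne.2 e (hj _ (by simp [sideEdge]))
      have e2 : j + 2 ≠ k + 1 := fun e => corner_apply_ne.2 e (hj _ (by simp [sideEdge]))
      clear h h' hj
      decide +revert

theorem eq_corner_one_of_F_eq_corner {i : Fin 6} {x : Pt} (hx : x ∈ Tri) {k : Fin 3}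
    (h : F i x = corner k) : x = corner 1 := by
  have h1 := (min_max_F i hx).2
  have hm : max (max (corner k 0) (corner k 1)) (corner k 2) = 1 := by
    fin_cases k <;> simp [corner]
  rw [h, hm] at h1
  obtain ⟨h0, -, h2, hs⟩ := mem_tri.1 hx
  ext j
  fin_cases j <;> simp [corner] <;> linarith

/-- At level `0` the shorting relation is trivial: a smaller cell contains at most one corner. -/
theorem eq_of_shortSetoid_zero {x y : VH 0} (h : shortSetoid 0 x y) : x = y := by
  change Relation.EqvGen _ _ _ at h
  induction h with
  | rel x y h =>
    obtain ⟨w, k, hx, hy⟩ := h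
    cases w with
    | nil => rw [eq_sideEdge_of_mem_sideH hx, eq_sideEdge_of_mem_sideH hy]
    | cons i w =>
      exfalso
      have hcor : ∀ p ∈ x.1, ∃ j, p = corner j := by
        obtain ⟨s, rfl⟩ := ofStar_surjective x
        intro p hp
        rcases s with - | j
        · simp only [ofStar, wholeTri, Finset.mem_insert, Finset.mem_singleton] at hp
          rcases hp with h | h | h <;> exact ⟨_, h⟩
        · simp only [ofStar, sideEdge, Finset.mem_insert, Finset.mem_singleton] at hp
          rcases hp with h | h <;> exact ⟨_, h⟩
      have hF : ∀ p ∈ x.1, p = F i (corner 1) := fun p hp => by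
        have hm : p ∈ segment ℝ (F i (Fword w (corner k))) (F i (Fword w (corner (k + 1)))) :=
          hx p hp
        rw [← image_F_segment] at hm
        obtain ⟨q, hq, rfl⟩ := hm
        obtain ⟨j, hj⟩ := hcor _ hp
        rw [eq_corner_one_of_F_eq_corner (segment_subset_tri (Fword_mem_tri _ (corner_mem_tri _))
          (Fword_mem_tri _ (corner_mem_tri _)) hq) hj]
      obtain ⟨p, hp, q, hq, hpq⟩ := Finset.one_lt_card.1 x.card_pos
      exact hpq ((hF p hp).trans (hF q hq).symm)
  | refl => rfl
  | symm _ _ _ ih => exact ih.symm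
  | trans _ _ _ _ _ ih ih' => exact ih.trans ih'

theorem condH_ofStar (κ : ℝ) (P Q : Option (Fin 3)) :
    condH κ 0 (ofStar P) (ofStar Q) = (star κ).cond P Q := by
  classical
  have h3 : (ofStar none).1.card = 3 := card_of_mem_tris (n := 0) (by simp [ofStar, wholeTri, T])
  have h2 : ∀ k, (ofStar (some k)).1.card = 2 := fun k =>
    Finset.card_pair (corner_ne (fin3_ne_add_one k))
  have hs : ∀ k, (ofStar (some k)).1 ⊆ (ofStar none).1 := fun k => by
    fin_cases k <;> simp [ofStar, sideEdge, wholeTri, Finset.subset_iff, fin3_one_add_one,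
      fin3_two_add_one]
  rw [condH_eq]
  rcases P with - | j <;> rcases Q with - | k <;> simp [AdjH, h3, h2, hs, star]

theorem isShorting_zero (κ : ℝ) :
    ∃ π, IsShorting κ 0 π := by
  let e := Equiv.ofBijective ofStar ⟨ofStar_injective, ofStar_surjective⟩
  have he : ∀ s, e.symm (ofStar s) = s := e.symm_apply_apply
  refine ⟨e.symm, e.symm.surjective, fun x y => ⟨fun h => ?_, fun h => ?_⟩, ?_, fun k x hx => ?_⟩
  · rw [e.symm.injective h]
  · rw [eq_of_shortSetoid_zero h]
  · have key : ∀ P Q : Option (Fin 3),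
        pushCond e.symm (condH κ 0) P Q = (star κ).cond P Q := fun P Q => by
      have := pushCond_apply_of_injective e.symm.injective (condH κ 0) (ofStar P) (ofStar Q)
      rwa [he, he, condH_ofStar] at this
    exact funext₂ key
  · rw [eq_sideEdge_of_mem_sideH hx]
    exact he (some k)

/-- The self-similar step: six presentations of `Γ_n`, one in each cell, are glued to a presentation
of `Γ_{n+1}`. -/
theorem IsShorting.succ {κ : ℝ} {n : ℕ} {π : VH n → (gasket κ n).V} (hπ : IsShorting κ n π) :
    ∃ π', IsShorting κ (n + 1) π' := by
  let N := gasket κ n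
  let q : Fin 6 × N.V → (glueSix N).V := Quotient.mk (Relation.EqvGen.setoid (GlueRel N))
  have hq : ∀ i j, q (i, N.cor j) = gluedCorner N i j := fun i j => rfl
  -- simplices common to two cells lie in a common side, which corresponds to a common corner
  have hwd : ∀ i j x y, cellMap n i x = cellMap n j y → q (i, π x) = q (j, π y) := by
    intro i j x y h
    obtain ⟨rfl, h'⟩ := cellMap_eq_cellMap h
    by_cases hij : i = j
    · rw [hij]
    rcases cells_inter_simplex (fun p => x.mem_tri) x.card_pos h' hij with ⟨h2, hk⟩ | ⟨h0, hk⟩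
    · rw [hπ.cor 2 x (mem_sideH.2 h2), hq, hq]
      rcases hk with ⟨k, ⟨rfl, rfl⟩ | ⟨rfl, rfl⟩⟩
      · exact gluedCorner_inner N k
      · exact (gluedCorner_inner N k).symm
    · rw [hπ.cor 0 x (mem_sideH.2 h0), hq, hq]
      rcases hk with ⟨k, ⟨rfl, rfl⟩ | ⟨rfl, rfl⟩⟩
      · exact gluedCorner_next N k
      · exact (gluedCorner_next N k).symm
  choose c y hcy using fun x : VH (n + 1) => exists_cellMap_eq x
  let π' : VH (n + 1) → (glueSix N).V := fun x => q (c x, π (y x))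
  have hπ' : ∀ i x, π' (cellMap n i x) = q (i, π x) := fun i x => hwd _ _ _ _ (hcy _)
  have hcor : ∀ k, ∀ x ∈ sideH (n + 1) k, π' x = (glueSix N).cor k := by
    intro k x hx
    obtain ⟨i, z, rfl⟩ := exists_cellMap_eq x
    obtain ⟨hz, hi⟩ := cellMap_mem_sideH hx
    rw [hπ', hπ.cor 1 z hz, hq]
    rcases hi with rfl | rfl
    · rfl
    · exact (gluedCorner_outer N k).symm
  refine ⟨π', ?_, fun x x' => ⟨fun h => ?_, fun h => ?_⟩, ?_, hcor⟩
  · intro P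
    obtain ⟨⟨i, v⟩, rfl⟩ := Quotient.exists_rep P
    obtain ⟨z, rfl⟩ := hπ.surj v
    exact ⟨cellMap n i z, hπ' i z⟩
  · -- glued vertices come from simplices which are shorted in `T_{n+1}`
    have hrep : ∀ k z, π z = N.cor k → ∃ z₀ ∈ sideH n k, shortSetoid n z z₀ := fun k z hz => by
      obtain ⟨z₀, h₀⟩ := sideH_nonempty n k
      exact ⟨z₀, h₀, (hπ.eq_iff _ _).1 (hz.trans (hπ.cor k z₀ h₀).symm)⟩
    have key : ∀ a b : Fin 6 × N.V, Relation.EqvGen (GlueRel N) a b → ∀ z z',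
        π z = a.2 → π z' = b.2 → shortSetoid (n + 1) (cellMap n a.1 z) (cellMap n b.1 z') := by
      intro a b hab
      induction hab with
      | rel a b hab =>
        intro z z' hz hz'
        have hzz : shortSetoid n z z' := (hπ.eq_iff _ _).1 <| by
          rw [hz, hz']
          cases hab <;> rfl
        refine (shortSetoid _).trans ?_ (shortSetoid_cellMap hzz b.1)
        cases hab with
        | outer k =>
          obtain ⟨z₀, h₀, hzz₀⟩ := hrep 1 z hz
          exact (shortSetoid _).trans (shortSetoid_cellMap hzz₀ _) <|
            (shortSetoid _).trans (shortSetoid_of_sideH (cellMap_even_mem_sideH h₀ k)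
              (cellMap_odd_mem_sideH h₀ k)) ((shortSetoid _).symm (shortSetoid_cellMap hzz₀ _))
        | inner k =>
          obtain ⟨z₀, h₀, hzz₀⟩ := hrep 2 z hz
          refine (shortSetoid _).trans (shortSetoid_cellMap hzz₀ _) ?_
          change shortSetoid (n + 1) (cellMap n (evenCell k) z₀) _
          rw [cellMap_even_eq_odd h₀]
          exact (shortSetoid _).symm (shortSetoid_cellMap hzz₀ _)
        | next k =>
          obtain ⟨z₀, h₀, hzz₀⟩ := hrep 0 z hz
          refine (shortSetoid _).trans (shortSetoid_cellMap hzz₀ _) ?_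
          change shortSetoid (n + 1) (cellMap n (oddCell k) z₀) _
          rw [cellMap_odd_eq_even h₀]
          exact (shortSetoid _).symm (shortSetoid_cellMap hzz₀ _)
      | refl a =>
        intro z z' hz hz'
        exact shortSetoid_cellMap ((hπ.eq_iff _ _).1 (hz.trans hz'.symm)) _
      | symm a b _ ih =>
        intro z z' hz hz'
        exact (shortSetoid _).symm (ih z' z hz' hz)
      | trans a b d _ _ ih ih' =>
        intro z z' hz hz'
        obtain ⟨z₀, h₀⟩ := hπ.surj b.2
        exact (shortSetoid _).trans (ih z z₀ hz h₀) (ih' z₀ z' h₀ hz')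
    have := key _ _ (Quotient.exact h) (y x) (y x') rfl rfl
    rwa [hcy, hcy] at this
  · -- the generators of the shorting relation are glued
    change Relation.EqvGen _ _ _ at h
    induction h with
    | rel x x' h =>
      obtain ⟨w, k, hx, hx'⟩ := h
      cases w with
      | nil => rw [hcor k x hx, hcor k x' hx']
      | cons i w =>
        have ht : ∀ k, Fword w (corner k) ∈ Tri := fun k => Fword_mem_tri w (corner_mem_tri k)
        obtain ⟨z, rfl, hz⟩ := exists_cellMap_eq_of_inSegment (ht k) (ht (k + 1)) hx
        obtain ⟨z', rfl, hz'⟩ := exists_cellMap_eq_of_inSegment (ht k) (ht (k + 1)) hx'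
        rw [hπ', hπ', (hπ.eq_iff z z').2 (Relation.EqvGen.rel _ _ ⟨w, k, hz, hz'⟩)]
    | refl => rfl
    | symm _ _ _ ih => exact ih.symm
    | trans _ _ _ _ _ ih ih' => exact ih.trans ih'
  · have e : π' ∘ (fun z : Fin 6 × VH n => cellMap n z.1 z.2) = q ∘ Prod.map id π :=
      funext fun z => hπ' z.1 z.2
    have h : pushCond π' (condH κ (n + 1)) = pushCond q (copiesCond N.cond) := by
      rw [← pushCond_cellMap, pushCond_comp, e, ← pushCond_comp, pushCond_copiesCond, hπ.cond]
    exact h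

theorem exists_isShorting (κ : ℝ) (n : ℕ) : ∃ π, IsShorting κ n π := by
  induction n with
  | zero => exact isShorting_zero κ
  | succ n ih =>
    obtain ⟨π, hπ⟩ := ih
    exact hπ.succ

/-- The shorted hexacarpet graph is isomorphic to the gasket graph. -/
theorem exists_equiv_gasket (κ : ℝ) (n : ℕ) : ∃ φ : VShort n ≃ (gasket κ n).V,
    (∀ P Q, (gasket κ n).cond (φ P) (φ Q) = condShort κ n P Q) ∧
      ∀ k, φ '' shortImage n (sideH n k) = {(gasket κ n).cor k} := by
  obtain ⟨π, hπ⟩ := exists_isShorting κ n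
  let φ : VShort n → (gasket κ n).V := Quotient.lift π fun x y h => (hπ.eq_iff x y).2 h
  have hφ : φ ∘ Quotient.mk (shortSetoid n) = π := rfl
  have hbij : Function.Bijective φ := by
    constructor
    · intro P Q
      induction P using Quotient.inductionOn
      induction Q using Quotient.inductionOn
      exact fun h => Quotient.sound ((hπ.eq_iff _ _).1 h)
    · intro v
      obtain ⟨x, rfl⟩ := hπ.surj v
      exact ⟨Quotient.mk _ x, rfl⟩
  refine ⟨Equiv.ofBijective φ hbij, fun P Q => ?_, fun k => ?_⟩
  · change (gasket κ n).cond (φ P) (φ Q) = pushCond (Quotient.mk (shortSetoid n)) (condH κ n) P Q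
    rw [← hπ.cond, ← hφ, ← pushCond_comp, pushCond_apply_of_injective hbij.1]
  · change φ '' (Quotient.mk (shortSetoid n) '' sideH n k) = _
    rw [← Set.image_comp, hφ]
    obtain ⟨x, hx⟩ := sideH_nonempty n k
    exact Set.Subset.antisymm (Set.image_subset_iff.2 fun x hx => hπ.cor k x hx)
      (Set.singleton_subset_iff.2 ⟨x, hx, hπ.cor k x hx⟩)

/-! ### Resistances of the shorted graph -/

theorem graphEnergy_condShort (κ : ℝ) (n : ℕ) (f : VShort n → ℝ) :
    graphEnergy (condShort κ n) f = graphEnergy (condH κ n) (f ∘ Quotient.mk (shortSetoid n)) :=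
  graphEnergy_pushCond _ _ _

/-- The shorted sides are single vertices, and the trace of the energy on them is a multiple of the
energy of a triangle. -/
theorem exists_shorted_sides {κ : ℝ} (hκ : 0 < κ) (n : ℕ) : ∃ σ : Fin 3 → VShort n,
    (∀ k, shortImage n (sideH n k) = {σ k}) ∧
    (∀ f : VShort n → ℝ,
      traceCond κ n * triForm (fun k => f (σ k)) ≤ graphEnergy (condShort κ n) f) ∧
    ∀ u : Fin 3 → ℝ, ∃ f : VShort n → ℝ, (∀ k, f (σ k) = u k) ∧
      graphEnergy (condShort κ n) f = traceCond κ n * triForm u := by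
  obtain ⟨φ, hφ, hσ⟩ := exists_equiv_gasket κ n
  have hcond : (gasket κ n).cond = pushCond φ (condShort κ n) := by
    ext P Q
    obtain ⟨P, rfl⟩ := φ.surjective P
    obtain ⟨Q, rfl⟩ := φ.surjective Q
    rw [hφ, pushCond_apply_of_injective φ.injective]
  have hE : ∀ g : (gasket κ n).V → ℝ,
      graphEnergy (condShort κ n) (g ∘ φ) = graphEnergy (gasket κ n).cond g := fun g => by
    rw [hcond, graphEnergy_pushCond]
  refine ⟨fun k => φ.symm ((gasket κ n).cor k), fun k => ?_, fun f => ?_, fun u => ?_⟩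
  · rw [← φ.symm_image_image (shortImage n (sideH n k)), hσ, Set.image_singleton]
  · have := traceCond_mul_triForm_le hκ n (f ∘ φ.symm)
    rwa [← hE, Function.comp_assoc, φ.symm_comp_self, Function.comp_id] at this
  · obtain ⟨g, hg, hgE⟩ := exists_graphEnergy_gasket_eq κ n u
    exact ⟨g ∘ φ, fun k => by simp [hg], (hE g).trans hgE⟩

theorem triForm_ge {u : Fin 3 → ℝ} {i j : Fin 3} (hij : i ≠ j) (hi : u i = 0) (hj : u j = 1) :
    3 / 2 ≤ triForm u := by
  have key : ∀ x : ℝ, 3 / 2 ≤ 1 + x ^ 2 + (1 - x) ^ 2 := fun x => by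
    nlinarith [sq_nonneg (2 * x - 1)]
  have h0 := key (u 0)
  have h1 := key (u 1)
  have h2 := key (u 2)
  unfold triForm
  fin_cases i <;> fin_cases j <;> first
    | exact absurd rfl hij
    | simp only [Fin.mk_zero, Fin.mk_one, Fin.reduceFinMk] at hi hj
      rw [hi, hj]
      linarith

theorem triForm_half {i j : Fin 3} (hij : i ≠ j) :
    triForm (fun k => if k = i then 0 else if k = j then 1 else 1 / 2) = 3 / 2 := by
  unfold triForm
  revert hij
  fin_cases i <;> fin_cases j <;> simp <;> norm_num

theorem triForm_zero_one_one : triForm ![0, 1, 1] = 2 := by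
  simp only [triForm, Matrix.cons_val]
  norm_num

theorem RShort_eq {κ : ℝ} (hκ : 0 < κ) (n : ℕ) {i j : Fin 3} (hij : i ≠ j) :
    RShort κ n i j = (traceCond κ n * (3 / 2))⁻¹ := by
  obtain ⟨σ, hσ, hle, hex⟩ := exists_shorted_sides hκ n
  rw [RShort, hσ, hσ]
  refine effRes_eq_inv (fun f h0 h1 => ?_) ?_
  · exact (mul_le_mul_of_nonneg_left (triForm_ge hij (h0 _ rfl) (h1 _ rfl))
      (traceCond_pos hκ n).le).trans (hle f)
  · obtain ⟨f, hf, hE⟩ := hex fun k => if k = i then 0 else if k = j then 1 else 1 / 2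
    refine ⟨f, ?_, ?_, hE.trans ?_⟩
    · rintro _ rfl
      simp [hf]
    · rintro _ rfl
      simp [hf, hij.symm]
    · rw [triForm_half hij]

/-! ### The half-sides -/

theorem mem_LH_succ {n : ℕ} {i : Fin 6} {x : VH (n + 1)} :
    x ∈ LH (n + 1) i ↔ ∃ z ∈ sideH n 1, cellMap n i z = x := by
  rw [LH, Set.mem_ofPred_eq, ← F_corner_one, ← F_corner_two]
  constructor
  · intro h
    obtain ⟨z, hz, hz'⟩ := exists_cellMap_eq_of_inSegment (corner_mem_tri _) (corner_mem_tri _) h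
    exact ⟨z, hz', hz⟩
  · rintro ⟨z, hz, rfl⟩
    exact inSegment_image.2 hz

theorem shortImage_LH {n : ℕ} {i : Fin 6} {k : Fin 3} (hi : i = evenCell k ∨ i = oddCell k)
    {v : VShort (n + 1)} (hv : shortImage (n + 1) (sideH (n + 1) k) = {v}) :
    shortImage (n + 1) (LH (n + 1) i) = {v} := by
  obtain ⟨z, hz⟩ := sideH_nonempty n 1
  have hne : (shortImage (n + 1) (LH (n + 1) i)).Nonempty :=
    ⟨_, _, mem_LH_succ.2 ⟨z, hz, rfl⟩, rfl⟩
  rw [← hne.subset_singleton_iff, ← hv]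
  refine Set.image_mono fun x hx => ?_
  obtain ⟨z, hz, rfl⟩ := mem_LH_succ.1 hx
  rcases hi with rfl | rfl
  · exact cellMap_even_mem_sideH hz k
  · exact cellMap_odd_mem_sideH hz k

theorem shortImage_AH {n : ℕ} {σ : Fin 3 → VShort (n + 1)}
    (hσ : ∀ k, shortImage (n + 1) (sideH (n + 1) k) = {σ k}) :
    shortImage (n + 1) (AH (n + 1)) = {σ 0} := by
  have h0 := shortImage_LH (i := 0) (Or.inl rfl) (hσ 0)
  have h1 := shortImage_LH (i := 1) (Or.inr rfl) (hσ 0)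
  rw [shortImage] at h0 h1
  rw [shortImage, AH, Set.image_union, h0, h1, Set.union_self]

theorem shortImage_BH {n : ℕ} {σ : Fin 3 → VShort (n + 1)}
    (hσ : ∀ k, shortImage (n + 1) (sideH (n + 1) k) = {σ k}) :
    shortImage (n + 1) (BH (n + 1)) = {σ 1, σ 2} := by
  have h0 := shortImage_LH (i := 3) (Or.inr rfl) (hσ 1)
  have h1 := shortImage_LH (i := 4) (Or.inl rfl) (hσ 2)
  rw [shortImage] at h0 h1
  rw [shortImage, BH, Set.image_union, h0, h1]
  rfl

theorem RShortAB_succ_eq {κ : ℝ} (hκ : 0 < κ) (n : ℕ) :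
    RShortAB κ (n + 1) = (traceCond κ (n + 1) * 2)⁻¹ := by
  obtain ⟨σ, hσ, hle, hex⟩ := exists_shorted_sides hκ (n + 1)
  rw [RShortAB, shortImage_AH hσ, shortImage_BH hσ]
  refine effRes_eq_inv (fun f h0 h1 => ?_) ?_
  · refine le_trans (le_of_eq ?_) (hle f)
    rw [triForm, h0 _ rfl, h1 _ (Or.inl rfl), h1 _ (Or.inr rfl)]
    norm_num
  · obtain ⟨f, hf, hE⟩ := hex ![0, 1, 1]
    refine ⟨f, ?_, ?_, hE.trans ?_⟩
    · rintro _ rfl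
      simp [hf]
    · rintro _ (rfl | rfl) <;> simp [hf]
    · rw [triForm_zero_one_one]

/-- The potential between the shorted half-sides, as a function on the hexacarpet graph. -/
theorem exists_potentialH {κ : ℝ} (hκ : 0 < κ) (n : ℕ) : ∃ h : VH (n + 1) → ℝ,
    (∀ a ∈ AH (n + 1), h a = 0) ∧ (∀ b ∈ BH (n + 1), h b = 1) ∧
      graphEnergy (condH κ (n + 1)) h = traceCond κ (n + 1) * 2 := by
  obtain ⟨σ, hσ, -, hex⟩ := exists_shorted_sides hκ (n + 1)
  obtain ⟨f, hf, hE⟩ := hex ![0, 1, 1]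
  refine ⟨f ∘ Quotient.mk (shortSetoid (n + 1)), fun a ha => ?_, fun b hb => ?_, ?_⟩
  · have : Quotient.mk _ a ∈ shortImage (n + 1) (AH (n + 1)) := ⟨a, ha, rfl⟩
    rw [shortImage_AH hσ] at this
    rw [Function.comp_apply, this, hf]
    rfl
  · have : Quotient.mk _ b ∈ shortImage (n + 1) (BH (n + 1)) := ⟨b, hb, rfl⟩
    rw [shortImage_BH hσ] at this
    rw [Function.comp_apply]
    rcases this with h | h <;> rw [h, hf] <;> rfl
  · rw [← graphEnergy_condShort, hE, triForm_zero_one_one]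

/-! ### Discrete Stokes formula -/

/-- The orientation of the cell map `F i`, relative to the orientation of `F 0`. -/
def cellSign (i : Fin 6) : ℝ := ![1, -1, 1, -1, 1, -1] i

/-- The pairing of the gradient of a function `f` on the 1-skeleton with the dual gradient of a
function `h` on the hexacarpet graph: the sum of `(f(b) - f(a)) (h([a,b]) - h(t))` over the
triangles `t` and their positively oriented edges `[a,b]`. -/
noncomputable def pairing : (n : ℕ) → (Pt → ℝ) → (VH n → ℝ) → ℝ
  | 0, f, h => ∑ k, (f (corner (k + 1)) - f (corner k)) * (h (sideEdge k) - h wholeTri)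
  | n + 1, f, h => ∑ i, cellSign i * pairing n (f ∘ F i) (h ∘ cellMap n i)

/-- The sum of `(f(b) - f(a)) h([a,b])` over the edges `[a,b]` in the side `k`, which is directed
from `p_k` to `p_{k+1}`. The cell `2k+1` traverses its half of this side in the opposite
direction. -/
noncomputable def sideSum : (n : ℕ) → Fin 3 → (Pt → ℝ) → (VH n → ℝ) → ℝ
  | 0, k, f, h => (f (corner (k + 1)) - f (corner k)) * h (sideEdge k)
  | n + 1, k, f, h => sideSum n 1 (f ∘ F (evenCell k)) (h ∘ cellMap n (evenCell k)) -
      sideSum n 1 (f ∘ F (oddCell k)) (h ∘ cellMap n (oddCell k))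

theorem F_corner_one_even (k : Fin 3) : F (evenCell k) (corner 1) = corner k := by
  rw [F_corner_one, outerCorner_eq]
  fin_cases k <;> rfl

theorem F_corner_one_odd (k : Fin 3) : F (oddCell k) (corner 1) = corner (k + 1) := by
  rw [F_corner_one, outerCorner_eq]
  fin_cases k <;> rfl

theorem F_corner_two_even (k : Fin 3) : F (evenCell k) (corner 2) = mid k := by
  rw [F_corner_two, outerMid_eq]
  fin_cases k <;> rfl

theorem F_corner_two_odd (k : Fin 3) : F (oddCell k) (corner 2) = mid k := by
  rw [F_corner_two, outerMid_eq]
  fin_cases k <;> rfl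

theorem corner_mem_verts (n : ℕ) (k : Fin 3) : corner k ∈ (T n).verts := by
  induction n generalizing k with
  | zero => fin_cases k <;> simp [T]
  | succ n ih =>
    exact ((isUnionOfCells_T n).verts _).2 ⟨_, _, ih 1, F_corner_one_even k⟩

theorem F_mem_verts {n : ℕ} {q : Pt} (hq : q ∈ (T n).verts) (i : Fin 6) :
    F i q ∈ (T (n + 1)).verts :=
  ((isUnionOfCells_T n).verts _).2 ⟨i, q, hq, rfl⟩

theorem corner_apply_side (k : Fin 3) : corner k (k + 2) = 0 ∧ corner (k + 1) (k + 2) = 0 := by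
  constructor <;> fin_cases k <;>
    simp [corner, fin3_one_add_one, fin3_one_add_two, fin3_two_add_one, fin3_two_add_two]

theorem sideSum_congr {n : ℕ} {k : Fin 3} {f f' : Pt → ℝ} {h h' : VH n → ℝ}
    (hf : ∀ p, p (k + 2) = 0 → f p = f' p) (hh : ∀ x ∈ sideH n k, h x = h' x) :
    sideSum n k f h = sideSum n k f' h' := by
  induction n generalizing k f f' with
  | zero =>
    rw [sideSum, sideSum, hf _ (corner_apply_side k).1, hf _ (corner_apply_side k).2,
      hh _ (sideEdge_mem_sideH k)]
  | succ n ih =>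
    rw [sideSum, sideSum]
    congr 1
    · exact ih (fun p hp => hf _ (F_apply_of_zero hp).1)
        fun x hx => hh _ (cellMap_even_mem_sideH hx k)
    · exact ih (fun p hp => hf _ (F_apply_of_zero hp).2)
        fun x hx => hh _ (cellMap_odd_mem_sideH hx k)

theorem sideSum_of_eq_const {n : ℕ} {k : Fin 3} (f : Pt → ℝ) {h : VH n → ℝ} {c : ℝ}
    (hh : ∀ x ∈ sideH n k, h x = c) :
    sideSum n k f h = c * (f (corner (k + 1)) - f (corner k)) := by
  induction n generalizing k f with
  | zero =>
    rw [sideSum, hh _ (sideEdge_mem_sideH k), mul_comm]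
  | succ n ih =>
    rw [sideSum, ih (h := h ∘ cellMap n (evenCell k)) _
        fun x hx => hh _ (cellMap_even_mem_sideH hx k),
      ih (h := h ∘ cellMap n (oddCell k)) _ fun x hx => hh _ (cellMap_odd_mem_sideH hx k)]
    simp only [fin3_one_add_one, Function.comp_apply, F_corner_one_even, F_corner_one_odd,
      F_corner_two_even, F_corner_two_odd]
    ring

theorem sideSum_eq_zero {n : ℕ} {k : Fin 3} {f : Pt → ℝ} (h : VH n → ℝ) {c : ℝ}
    (hf : ∀ q ∈ (T n).verts, q (k + 2) = 0 → f q = c) : sideSum n k f h = 0 := by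
  induction n generalizing k f with
  | zero =>
    rw [sideSum, hf _ (corner_mem_verts 0 _) (corner_apply_side k).1,
      hf _ (corner_mem_verts 0 _) (corner_apply_side k).2, sub_self, zero_mul]
  | succ n ih =>
    rw [sideSum, ih (k := 1) (f := f ∘ F (evenCell k)) _
        fun q hq h0 => hf _ (F_mem_verts hq _) (F_apply_of_zero h0).1,
      ih (k := 1) (f := f ∘ F (oddCell k)) _
        fun q hq h0 => hf _ (F_mem_verts hq _) (F_apply_of_zero h0).2, sub_self]

/-- Discrete Stokes formula: around each triangle the differences of `f` add up to zero, and edges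
common to two triangles are traversed in opposite directions. -/
theorem pairing_eq_sum_sideSum {n : ℕ} (f : Pt → ℝ) (h : VH n → ℝ) :
    pairing n f h = ∑ k, sideSum n k f h := by
  induction n generalizing f with
  | zero =>
    simp only [pairing, sideSum, Fin.sum_univ_three, zero_add, fin3_one_add_one,
      fin3_two_add_one]
    ring
  | succ n ih =>
    have h2 : ∀ k, sideSum n 2 (f ∘ F (evenCell k)) (h ∘ cellMap n (evenCell k)) =
        sideSum n 2 (f ∘ F (oddCell k)) (h ∘ cellMap n (oddCell k)) := fun k =>
      sideSum_congr (fun p hp => congrArg f (F_even_eq_F_odd hp))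
        fun x hx => congrArg h (cellMap_even_eq_odd hx k)
    have h0 : ∀ k, sideSum n 0 (f ∘ F (oddCell k)) (h ∘ cellMap n (oddCell k)) =
        sideSum n 0 (f ∘ F (evenCell (k + 1))) (h ∘ cellMap n (evenCell (k + 1))) := fun k =>
      sideSum_congr (fun p hp => congrArg f (F_odd_eq_F_even hp))
        fun x hx => congrArg h (cellMap_odd_eq_even hx k)
    have he : ∀ k, cellSign (evenCell k) = 1 := fun k => by fin_cases k <;> rfl
    have ho : ∀ k, cellSign (oddCell k) = -1 := fun k => by fin_cases k <;> rfl
    simp only [pairing, sideSum, ih, sum_cells, he, ho, Fin.sum_univ_three, h2, h0, zero_add,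
      fin3_one_add_one, fin3_two_add_one]
    ring

theorem pairing_eq_one {n : ℕ} {f : Pt → ℝ} {h : VH (n + 1) → ℝ}
    (hf0 : ∀ q ∈ (T (n + 1)).verts, q ∈ segment ℝ (outerCorner 2) (outerMid 2) → f q = 0)
    (hf1 : ∀ q ∈ (T (n + 1)).verts, q ∈ segment ℝ (outerCorner 5) (outerMid 5) → f q = 1)
    (h0 : ∀ a ∈ AH (n + 1), h a = 0) (h1 : ∀ b ∈ BH (n + 1), h b = 1) :
    pairing (n + 1) f h = 1 := by
  have hseg : ∀ (i : Fin 6) (q : Pt), q ∈ (T n).verts → q (1 + 2) = 0 →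
      F i q ∈ segment ℝ (outerCorner i) (outerMid i) := fun i q hq hq0 => by
    rw [← F_corner_one, ← F_corner_two]
    exact F_mem_segment.2 (mem_segment_corner.2 ⟨verts_subset_tri hq, hq0⟩)
  have c0 : sideSum n 1 (f ∘ F (evenCell 0)) (h ∘ cellMap n (evenCell 0)) = 0 :=
    (sideSum_of_eq_const _ fun x hx => h0 _ (Or.inl (mem_LH_succ.2 ⟨x, hx, rfl⟩))).trans
      (zero_mul _)
  have c1 : sideSum n 1 (f ∘ F (oddCell 0)) (h ∘ cellMap n (oddCell 0)) = 0 :=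
    (sideSum_of_eq_const _ fun x hx => h0 _ (Or.inr (mem_LH_succ.2 ⟨x, hx, rfl⟩))).trans
      (zero_mul _)
  have c2 : sideSum n 1 (f ∘ F (evenCell 1)) (h ∘ cellMap n (evenCell 1)) = 0 :=
    sideSum_eq_zero _ fun q hq hq0 => hf0 _ (F_mem_verts hq _) (hseg 2 q hq hq0)
  have c3 := sideSum_of_eq_const (n := n) (k := 1) (f ∘ F (oddCell 1))
    (h := h ∘ cellMap n (oddCell 1)) fun x hx => h1 _ (Or.inl (mem_LH_succ.2 ⟨x, hx, rfl⟩))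
  have c4 := sideSum_of_eq_const (n := n) (k := 1) (f ∘ F (evenCell 2))
    (h := h ∘ cellMap n (evenCell 2)) fun x hx => h1 _ (Or.inr (mem_LH_succ.2 ⟨x, hx, rfl⟩))
  have c5 : sideSum n 1 (f ∘ F (oddCell 2)) (h ∘ cellMap n (oddCell 2)) = 0 :=
    sideSum_eq_zero _ fun q hq hq0 => hf1 _ (F_mem_verts hq _) (hseg 5 q hq hq0)
  have m1 : f (mid 1) = 0 := hf0 _
    (F_corner_two_even 1 ▸ F_mem_verts (corner_mem_verts n 2) _) (right_mem_segment _ _ _)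
  have m2 : f (mid 2) = 1 := hf1 _
    (F_corner_two_even 2 ▸ F_mem_verts (corner_mem_verts n 2) _) (right_mem_segment _ _ _)
  rw [pairing_eq_sum_sideSum, Fin.sum_univ_three, sideSum, sideSum, sideSum, c0, c1, c2, c3, c4, c5]
  simp only [fin3_one_add_one, Function.comp_apply, F_corner_one_even, F_corner_one_odd,
    F_corner_two_even, F_corner_two_odd, m1, m2]
  ring

/-! ### The energy inequality of planar duality -/

theorem tris_succ (n : ℕ) : (T (n + 1)).tris =
    Finset.univ.biUnion fun i => (T n).tris.image (Finset.image (F i)) := by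
  ext t
  simp [(isUnionOfCells_T n).tris]

theorem sum_tris_succ (n : ℕ) (g : Finset Pt → ℝ) :
    ∑ t ∈ (T (n + 1)).tris, g t = ∑ i, ∑ t ∈ (T n).tris, g (t.image (F i)) := by
  have htri : ∀ t ∈ (T n).tris, ∀ p ∈ t, p ∈ Tri := fun t ht p hp =>
    verts_subset_tri (subset_verts_of_mem_tris ht hp)
  rw [tris_succ, Finset.sum_biUnion]
  · exact Finset.sum_congr rfl fun i _ =>
      Finset.sum_image (Finset.image_injective (F_injective i)).injOn
  · intro i _ j _ hij
    refine Finset.disjoint_left.2 fun t hi hj => hij ?_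
    obtain ⟨s, hs, rfl⟩ := Finset.mem_image.1 hi
    obtain ⟨s', hs', e⟩ := Finset.mem_image.1 hj
    exact eq_of_F_eq_F_on_tri hs (image_F_eq_image_F (htri s hs) (htri s' hs') e.symm).2

/-- The sum over the triangles of `T_n` of the energies of `f` on their boundaries, with unit
conductances. -/
noncomputable def triEnergy (n : ℕ) (f : Pt → ℝ) : ℝ :=
  ∑ t ∈ (T n).tris, (1 / 2) * ∑ p ∈ t, ∑ q ∈ t, (f p - f q) ^ 2

theorem triEnergy_zero (f : Pt → ℝ) :
    triEnergy 0 f = ∑ k, (f (corner (k + 1)) - f (corner k)) ^ 2 := by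
  have h0 : corner 0 ∉ ({corner 1, corner 2} : Finset Pt) := by
    simp [corner_injective.eq_iff]
  have hs : ∀ g : Pt → ℝ, ∑ p ∈ ({corner 0, corner 1, corner 2} : Finset Pt), g p =
      g (corner 0) + (g (corner 1) + g (corner 2)) := fun g => by
    rw [Finset.sum_insert h0, Finset.sum_pair (corner_ne (by decide))]
  simp only [triEnergy, T, Finset.sum_singleton, hs, Fin.sum_univ_three, zero_add,
    fin3_one_add_one, fin3_two_add_one]
  ring

theorem triEnergy_succ (n : ℕ) (f : Pt → ℝ) : triEnergy (n + 1) f = ∑ i, triEnergy n (f ∘ F i) := by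
  rw [triEnergy, sum_tris_succ]
  refine Finset.sum_congr rfl fun i _ => Finset.sum_congr rfl fun t _ => ?_
  simp only [Finset.sum_image (F_injective i).injOn, Function.comp_apply]

theorem graphEnergy_condH_zero (κ : ℝ) (h : VH 0 → ℝ) :
    graphEnergy (condH κ 0) h = κ * ∑ k, (h (sideEdge k) - h wholeTri) ^ 2 := by
  have e : condH κ 0 = pushCond ofStar (star κ).cond := by
    ext x y
    obtain ⟨P, rfl⟩ := ofStar_surjective x
    obtain ⟨Q, rfl⟩ := ofStar_surjective y
    exact (condH_ofStar κ P Q).trans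
      (pushCond_apply_of_injective ofStar_injective (star κ).cond P Q).symm
  rw [e]
  exact (graphEnergy_pushCond _ _ _).trans (graphEnergy_star κ (h ∘ ofStar))

/-- Cauchy–Schwarz inequality for the pairing. -/
theorem sq_pairing_le {κ : ℝ} (hκ : 0 < κ) {n : ℕ} (f : Pt → ℝ) (h : VH n → ℝ) :
    pairing n f h ^ 2 ≤ triEnergy n f * (κ⁻¹ * graphEnergy (condH κ n) h) := by
  induction n generalizing f with
  | zero =>
    rw [triEnergy_zero, graphEnergy_condH_zero, inv_mul_cancel_left₀ hκ.ne', pairing]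
    exact Finset.sum_mul_sq_le_sq_mul_sq _ _ _
  | succ n ih =>
    rw [triEnergy_succ, graphEnergy_condH_succ, Finset.mul_sum, pairing]
    refine Finset.sum_sq_le_sum_mul_sum_of_sq_le_mul _ (fun i _ => ?_) (fun i _ => ?_)
      fun i _ => ?_
    · exact Finset.sum_nonneg fun t _ => mul_nonneg (by norm_num)
        (Finset.sum_nonneg fun p _ => Finset.sum_nonneg fun q _ => sq_nonneg _)
    · exact mul_nonneg (inv_nonneg.2 hκ.le) (graphEnergy_nonneg (condH_nonneg hκ.le) _)
    · have hs : cellSign i ^ 2 = 1 := by fin_cases i <;> norm_num [cellSign]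
      rw [mul_pow, hs, one_mul]
      exact ih _ _

/-! ### Every edge lies in at most two triangles -/

theorem card_neighbours_le : ∀ i : Fin 6,
    (Finset.univ.filter fun j => j = i ∨
      ∃ k, (i = evenCell k ∧ j = oddCell k) ∨ (j = evenCell k ∧ i = oddCell k)).card ≤ 2 ∧
    (Finset.univ.filter fun j => j = i ∨
      ∃ k, (i = oddCell k ∧ j = evenCell (k + 1)) ∨
        (j = oddCell k ∧ i = evenCell (k + 1))).card ≤ 2 := by
  decide

/-- The triangles around an edge of the cell `i`, in terms of the triangles around the same edge in
the cells `j ∈ J` which contain it. -/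
theorem card_tris_succ_le {n : ℕ} {i : Fin 6} {d : Finset Pt} (hd : ∀ p ∈ d, p ∈ Tri)
    {J : Finset (Fin 6)} (hJ : ∀ j, (∀ p ∈ d, F i p = F j p) → j ∈ J) :
    ((T (n + 1)).tris.filter fun t => d.image (F i) ⊆ t).card ≤
      J.card * ((T n).tris.filter fun t => d ⊆ t).card := by
  refine le_trans (Finset.card_le_card (t := J.biUnion fun j =>
    ((T n).tris.filter fun t => d ⊆ t).image (Finset.image (F j))) ?_)
    (Finset.card_biUnion_le_card_mul _ _ _ fun j _ => Finset.card_image_le)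
  intro t ht
  obtain ⟨ht, hdt⟩ := Finset.mem_filter.1 ht
  obtain ⟨j, s, hs, rfl⟩ := ((isUnionOfCells_T n).tris t).1 ht
  have key : ∀ p ∈ d, p ∈ s ∧ F i p = F j p := fun p hp => by
    obtain ⟨q, hq, e⟩ := Finset.mem_image.1 (hdt (Finset.mem_image_of_mem _ hp))
    obtain rfl := eq_of_F_eq_F (verts_subset_tri (subset_verts_of_mem_tris hs hq)) (hd p hp) e
    exact ⟨hq, e.symm⟩
  exact Finset.mem_biUnion.2 ⟨j, hJ j fun p hp => (key p hp).2, Finset.mem_image_of_mem _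
    (Finset.mem_filter.2 ⟨hs, fun p hp => (key p hp).1⟩)⟩

theorem fin3_add_one_add_two (k : Fin 3) : k + 1 + 2 = k := by decide +revert

/-- A pair of points lies in at most two triangles, and in at most one triangle if it lies in a side
of the whole triangle. -/
theorem card_tris_le {n : ℕ} {e : Finset Pt} (he : e.card = 2) :
    ((T n).tris.filter fun t => e ⊆ t).card ≤ 2 ∧
    ((∃ k : Fin 3, ∀ p ∈ e, p k = 0) → ((T n).tris.filter fun t => e ⊆ t).card ≤ 1) := by
  induction n generalizing e with
  | zero =>
    have : ((T 0).tris.filter fun t => e ⊆ t).card ≤ 1 := by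
      refine (Finset.card_filter_le _ _).trans ?_
      simp [T]
    exact ⟨this.trans one_le_two, fun _ => this⟩
  | succ n ih =>
    rcases Finset.eq_empty_or_nonempty ((T (n + 1)).tris.filter fun t => e ⊆ t) with h0 | ⟨t, ht⟩
    · rw [h0]
      simp
    obtain ⟨ht, het⟩ := Finset.mem_filter.1 ht
    obtain ⟨i, s, hs, rfl⟩ := ((isUnionOfCells_T n).tris t).1 ht
    obtain ⟨d, hds, rfl⟩ := Finset.subset_image_iff.1 het
    have hd : ∀ p ∈ d, p ∈ Tri := fun p hp =>
      verts_subset_tri (subset_verts_of_mem_tris hs (by exact_mod_cast hds hp))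
    rw [Finset.card_image_of_injective _ (F_injective i)] at he
    obtain ⟨ih2, ih1⟩ := ih he
    have hd1 : 1 < d.card := by omega
    by_cases hu : ∀ j, (∀ p ∈ d, F i p = F j p) → j ∈ ({i} : Finset (Fin 6))
    · have hle := card_tris_succ_le (n := n) hd hu
      rw [Finset.card_singleton, one_mul] at hle
      refine ⟨hle.trans ih2, ?_⟩
      rintro ⟨k, hk⟩
      refine hle.trans (ih1 ⟨0, ?_⟩)
      refine (simplex_subset_side (i := i) (k := k + 1) hd hd1 ?_).1
      rw [fin3_add_one_add_two]
      exact Finset.forall_mem_image.1 hk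
    · push Not at hu
      obtain ⟨j, hj, hij⟩ := hu
      have hij' : i ≠ j := fun h => hij (by simp [h])
      have hne := Finset.one_lt_card.1 hd1
      obtain ⟨p, hp, q, hq, hpq⟩ := hne
      -- the edge lies in the side `x₁ = 0` or `x₂ = 0` of its cell, hence in no other one
      have huniq : ∀ {a b : Fin 3}, a ≠ b → (∀ p ∈ d, p a = 0) → ¬∀ p ∈ d, p b = 0 :=
        fun hab ha hb => hpq (eq_corner_of_eq_zero (hd p hp) (hd q hq) hab (ha p hp) (hb p hp)
          (ha q hq) (hb q hq))
      have hside : ∃ c : Fin 3, c ≠ 0 ∧ ∀ p ∈ d, p c = 0 := by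
        rcases cells_inter_simplex hd hd1 hj hij' with ⟨h, -⟩ | ⟨h, -⟩
        · exact ⟨1, by decide, h⟩
        · exact ⟨2, by decide, h⟩
      obtain ⟨c, hc, hdc⟩ := hside
      constructor
      · have hJ : ∃ J : Finset (Fin 6), J.card ≤ 2 ∧
            ∀ j, (∀ p ∈ d, F i p = F j p) → j ∈ J := by
          rcases cells_inter_simplex hd hd1 hj hij' with ⟨h, -⟩ | ⟨h, -⟩
          · refine ⟨_, (card_neighbours_le i).1, fun l hl => ?_⟩
            refine Finset.mem_filter.2 ⟨Finset.mem_univ _, or_iff_not_imp_left.2 fun hli => ?_⟩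
            rcases cells_inter_simplex hd hd1 hl (Ne.symm hli) with ⟨-, hk⟩ | ⟨h', -⟩
            · exact hk
            · exact absurd h' (huniq (by decide) h)
          · refine ⟨_, (card_neighbours_le i).2, fun l hl => ?_⟩
            refine Finset.mem_filter.2 ⟨Finset.mem_univ _, or_iff_not_imp_left.2 fun hli => ?_⟩
            rcases cells_inter_simplex hd hd1 hl (Ne.symm hli) with ⟨h', -⟩ | ⟨-, hk⟩
            · exact absurd h' (huniq (by decide) h)
            · exact hk
        obtain ⟨J, hJ2, hJ⟩ := hJ
        exact (card_tris_succ_le hd hJ).trans (Nat.mul_le_mul hJ2 (ih1 ⟨c, hdc⟩))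
      · rintro ⟨k, hk⟩
        refine absurd ?_ (huniq hc hdc)
        refine (simplex_subset_side (i := i) (k := k + 1) hd hd1 ?_).1
        rw [fin3_add_one_add_two]
        exact Finset.forall_mem_image.1 hk

/-- The energy on the boundaries of all triangles is comparable to the energy of the 1-skeleton:
interior edges are counted twice and boundary edges once. -/
theorem triEnergy_le {β : ℝ} (hβ : 0 < β) {n : ℕ} (f : Pt → ℝ) :
    triEnergy n f ≤ max 2 β⁻¹ * graphEnergy (condT β n) fun q => f q.1 := by
  have hcount : triEnergy n f = 1 / 2 * ∑ p ∈ (T n).verts, ∑ q ∈ (T n).verts,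
      ((T n).tris.filter fun t => {p, q} ⊆ t).card * (f p - f q) ^ 2 := by
    have h1 : ∀ t ∈ (T n).tris, ∑ p ∈ t, ∑ q ∈ t, (f p - f q) ^ 2 =
        ∑ p ∈ (T n).verts, ∑ q ∈ (T n).verts, if {p, q} ⊆ t then (f p - f q) ^ 2 else 0 := by
      intro t ht
      have hinter : (T n).verts ∩ t = t :=
        Finset.inter_eq_right.2 (subset_verts_of_mem_tris ht)
      simp only [Finset.insert_subset_iff, Finset.singleton_subset_iff, ite_and,
        Finset.sum_ite_irrel, Finset.sum_const_zero, Finset.sum_ite_mem, hinter]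
    rw [triEnergy, ← Finset.mul_sum, Finset.sum_congr rfl h1, Finset.sum_comm]
    congr 1
    refine Finset.sum_congr rfl fun p _ => ?_
    rw [Finset.sum_comm]
    refine Finset.sum_congr rfl fun q _ => ?_
    rw [← Finset.sum_filter, Finset.sum_const, nsmul_eq_mul]
  have henergy : (graphEnergy (condT β n) fun q => f q.1) = 1 / 2 * ∑ p : VT n, ∑ q : VT n,
      condT β n p q * (f p.1 - f q.1) ^ 2 := by
    rw [graphEnergy_eq_sum, Fintype.sum_prod_type]
  rw [hcount, henergy, mul_left_comm, ← Finset.sum_coe_sort]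
  refine mul_le_mul_of_nonneg_left ?_ (by norm_num)
  rw [Finset.mul_sum]
  refine Finset.sum_le_sum fun p _ => ?_
  rw [Finset.mul_sum, ← Finset.sum_coe_sort]
  refine Finset.sum_le_sum fun q _ => ?_
  rw [← mul_assoc]
  by_cases hpq : p.1 = q.1
  · rw [hpq, sub_self]
    simp
  refine mul_le_mul_of_nonneg_right ?_ (sq_nonneg _)
  have hM : (0 : ℝ) < max 2 β⁻¹ := lt_max_of_lt_left two_pos
  have h2 := (card_tris_le (n := n) (Finset.card_pair hpq)).1
  rw [condT]
  rcases Finset.eq_empty_or_nonempty ((T n).tris.filter fun t => {p.1, q.1} ⊆ t) with h0 | ⟨t, ht⟩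
  · rw [h0, Finset.card_empty, Nat.cast_zero]
    refine mul_nonneg hM.le ?_
    split_ifs
    exacts [zero_le_one, hβ.le, le_rfl]
  · obtain ⟨ht, hs⟩ := Finset.mem_filter.1 ht
    rw [if_pos (pair_mem_edges ht (hs (by simp)) (hs (by simp)) hpq)]
    split_ifs with hc
    · rw [mul_one]
      exact le_trans (by exact_mod_cast h2) (le_max_left _ _)
    · have h1 : ((T n).tris.filter fun t => {p.1, q.1} ⊆ t).card ≤ 1 := by omega
      calc _ ≤ (1 : ℝ) := by exact_mod_cast h1
        _ = β⁻¹ * β := (inv_mul_cancel₀ hβ.ne').symm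
        _ ≤ _ := mul_le_mul_of_nonneg_right (le_max_right _ _) hβ.le

/-! ### Bounds for the resistances -/

/-- The energies of admissible functions on the 1-skeleton and on the hexacarpet graph have a
product bounded below: this is one half of the duality of their resistances. -/
theorem one_le_energy_mul_energy {κ β : ℝ} (hκ : 0 < κ) (hβ : 0 < β) {n : ℕ}
    {f : VT (n + 1) → ℝ} {h : VH (n + 1) → ℝ}
    (hf0 : ∀ q ∈ LT (n + 1) 2, f q = 0) (hf1 : ∀ q ∈ LT (n + 1) 5, f q = 1)
    (h0 : ∀ a ∈ AH (n + 1), h a = 0) (h1 : ∀ b ∈ BH (n + 1), h b = 1) :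
    1 ≤ max 2 β⁻¹ * graphEnergy (condT β (n + 1)) f *
      (κ⁻¹ * graphEnergy (condH κ (n + 1)) h) := by
  classical
  let g : Pt → ℝ := fun q => if hq : q ∈ (T (n + 1)).verts then f ⟨q, hq⟩ else 0
  have hg : ∀ q : VT (n + 1), g q.1 = f q := fun q => dif_pos q.2
  have hp : pairing (n + 1) g h = 1 := pairing_eq_one
    (fun q hq hs => (hg ⟨q, hq⟩).trans (hf0 _ hs)) (fun q hq hs => (hg ⟨q, hq⟩).trans (hf1 _ hs))
    h0 h1
  have hcs := sq_pairing_le hκ g h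
  rw [hp, one_pow] at hcs
  refine hcs.trans (mul_le_mul_of_nonneg_right ?_
    (mul_nonneg (inv_nonneg.2 hκ.le) (graphEnergy_nonneg (condH_nonneg hκ.le) h)))
  have := triEnergy_le hβ (n := n + 1) g
  simpa only [hg] using this

/-- The half-sides `ℓ_2` and `ℓ_5` are disjoint, so that there are admissible functions. -/
theorem exists_admissibleT (n : ℕ) : ∃ f : VT n → ℝ,
    (∀ q ∈ LT n 2, f q = 0) ∧ ∀ q ∈ LT n 5, f q = 1 := by
  refine ⟨(LT n 5).indicator 1, fun q hq => Set.indicator_of_notMem (fun hq' => ?_) _,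
    fun q hq => Set.indicator_of_mem hq _⟩
  -- `x₀` vanishes on `ℓ_2` and is at least `1/2` on `ℓ_5`
  rw [LT, Set.mem_ofPred_eq, ← F_corner_one, ← F_corner_two, ← image_F_segment] at hq hq'
  obtain ⟨x, hx, hxq⟩ := hq
  obtain ⟨y, hy, hyq⟩ := hq'
  have hx' := (mem_segment_corner (k := 1)).1 hx
  have hy' := (mem_segment_corner (k := 1)).1 hy
  have h := congrFun (hxq.trans hyq.symm) 0
  rw [F_eq, F_eq] at h
  obtain ⟨-, -, -, hs⟩ := mem_tri.1 hy'.1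
  obtain ⟨-, p1, p2, -⟩ := mem_tri.1 hy'.1
  have e1 := hx'.2
  have e2 := hy'.2
  rw [fin3_one_add_two] at e1 e2
  simp only [Matrix.cons_val, e1, e2] at h
  linarith

theorem exists_lower_bound_energyH {κ : ℝ} (hκ : 0 < κ) (n : ℕ) : ∃ m : ℝ, 0 < m ∧
    ∀ h : VH (n + 1) → ℝ, (∀ a ∈ AH (n + 1), h a = 0) → (∀ b ∈ BH (n + 1), h b = 1) →
      m ≤ graphEnergy (condH κ (n + 1)) h := by
  obtain ⟨f, hf0, hf1⟩ := exists_admissibleT (n + 1)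
  have key : ∀ h : VH (n + 1) → ℝ, (∀ a ∈ AH (n + 1), h a = 0) → (∀ b ∈ BH (n + 1), h b = 1) →
      1 ≤ max 2 (1 : ℝ)⁻¹ * graphEnergy (condT 1 (n + 1)) f * κ⁻¹ *
        graphEnergy (condH κ (n + 1)) h := fun h h0 h1 => by
    rw [mul_assoc _ κ⁻¹]
    exact one_le_energy_mul_energy hκ one_pos hf0 hf1 h0 h1
  generalize max 2 (1 : ℝ)⁻¹ * graphEnergy (condT 1 (n + 1)) f * κ⁻¹ = a at key
  obtain ⟨h, h0, h1, hE⟩ := exists_potentialH hκ n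
  have ha : 0 < a := by
    have := key h h0 h1
    rw [hE] at this
    have ht := traceCond_pos hκ (n + 1)
    exact pos_of_mul_pos_left (one_pos.trans_le this) (by positivity)
  refine ⟨a⁻¹, inv_pos.2 ha, fun h h0 h1 => ?_⟩
  rw [inv_le_iff_one_le_mul₀' ha]
  exact key h h0 h1

theorem inv_traceCond_le_RH {κ : ℝ} (hκ : 0 < κ) (n : ℕ) :
    (traceCond κ (n + 1) * 2)⁻¹ ≤ RH κ (n + 1) := by
  obtain ⟨m, hm, hle⟩ := exists_lower_bound_energyH hκ n
  obtain ⟨h, h0, h1, hE⟩ := exists_potentialH hκ n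
  rw [← hE]
  exact inv_graphEnergy_le_effRes hm hle h0 h1

theorem RT_pos_and_le {β : ℝ} (hβ : 0 < β) (n : ℕ) :
    0 < RT β (n + 1) ∧ RT β (n + 1) ≤ max 2 β⁻¹ * (2 / 3) * (4 / 5) ^ (n + 1) := by
  have ht := traceCond_pos one_pos (n + 1)
  have hM : (0 : ℝ) < max 2 β⁻¹ := lt_max_of_lt_left two_pos
  obtain ⟨h, h0, h1, hE⟩ := exists_potentialH one_pos n
  have hm : 0 < max 2 β⁻¹ * (traceCond 1 (n + 1) * 2) := by positivity
  have := effRes_pos_and_le (inv_pos.2 hm) (c := condT β (n + 1)) (A := LT (n + 1) 2)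
    (B := LT (n + 1) 5) (fun f hf0 hf1 => ?_) (exists_admissibleT (n + 1))
  · refine ⟨this.1, this.2.trans_eq ?_⟩
    rw [inv_inv, traceCond]
    ring
  · have := one_le_energy_mul_energy one_pos hβ hf0 hf1 h0 h1
    rw [hE, inv_one, one_mul, mul_right_comm] at this
    rwa [inv_le_iff_one_le_mul₀' hm]

/-! ### Exponential growth rates -/

theorem log_mul_pow_div {c r : ℝ} (hc : 0 < c) (hr : 0 < r) {n : ℕ} (hn : 1 ≤ n) :
    Real.log (c * r ^ n) / n = Real.log c / n + Real.log r := by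
  have : (n : ℝ) ≠ 0 := by positivity
  rw [Real.log_mul hc.ne' (pow_pos hr n).ne', Real.log_pow]
  field_simp

theorem tendsto_log_div_add_log (c r : ℝ) :
    Tendsto (fun n : ℕ => Real.log c / n + Real.log r) atTop (𝓝 (Real.log r)) := by
  simpa using (tendsto_const_div_atTop_nhds_zero_nat (Real.log c)).add_const (Real.log r)

theorem eventually_le_log_div {R : ℕ → ℝ} {c r : ℝ} (hc : 0 < c) (hr : 0 < r)
    (h : ∀ n, 1 ≤ n → c * r ^ n ≤ R n) :
    ∀ᶠ n : ℕ in atTop, Real.log c / n + Real.log r ≤ Real.log (R n) / n := by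
  filter_upwards [eventually_ge_atTop 1] with n hn
  rw [← log_mul_pow_div hc hr hn]
  exact div_le_div_of_nonneg_right (Real.log_le_log (by positivity) (h n hn)) n.cast_nonneg

theorem eventually_log_div_le {R : ℕ → ℝ} {c r : ℝ} (hc : 0 < c) (hr : 0 < r)
    (h : ∀ n, 1 ≤ n → 0 < R n ∧ R n ≤ c * r ^ n) :
    ∀ᶠ n : ℕ in atTop, Real.log (R n) / n ≤ Real.log c / n + Real.log r := by
  filter_upwards [eventually_ge_atTop 1] with n hn
  rw [← log_mul_pow_div hc hr hn]
  exact div_le_div_of_nonneg_right (Real.log_le_log (h n hn).1 (h n hn).2) n.cast_nonneg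

theorem log_le_liminf {R : ℕ → ℝ} {c r : ℝ} (hc : 0 < c) (hr : 0 < r)
    (h : ∀ n, 1 ≤ n → c * r ^ n ≤ R n) : ((Real.log r : ℝ) : EReal) ≤
      liminf (fun n : ℕ => ((Real.log (R n) / n : ℝ) : EReal)) atTop := by
  rw [← (continuous_coe_real_ereal.tendsto _ |>.comp (tendsto_log_div_add_log c r)).liminf_eq]
  refine liminf_le_liminf ?_
  filter_upwards [eventually_le_log_div hc hr h] with n hn
  exact EReal.coe_le_coe_iff.2 hn

theorem limsup_le_log {R : ℕ → ℝ} {c r : ℝ} (hc : 0 < c) (hr : 0 < r)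
    (h : ∀ n, 1 ≤ n → 0 < R n ∧ R n ≤ c * r ^ n) :
    limsup (fun n : ℕ => ((Real.log (R n) / n : ℝ) : EReal)) atTop ≤
      ((Real.log r : ℝ) : EReal) := by
  rw [← (continuous_coe_real_ereal.tendsto _ |>.comp (tendsto_log_div_add_log c r)).limsup_eq]
  refine limsup_le_limsup ?_
  filter_upwards [eventually_log_div_le hc hr h] with n hn
  exact EReal.coe_le_coe_iff.2 hn

theorem IsScalingConstant.le {R : ℕ → ℝ} {ρ c r : ℝ} (hρ : IsScalingConstant R ρ) (hc : 0 < c)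
    (hr : 0 < r) (h : ∀ n, 1 ≤ n → c * r ^ n ≤ R n) : r ≤ ρ :=
  (Real.log_le_log_iff hr hρ.1).1 <|
    le_of_tendsto_of_tendsto (tendsto_log_div_add_log c r) hρ.2 (eventually_le_log_div hc hr h)

theorem IsScalingConstant.ge {R : ℕ → ℝ} {ρ c r : ℝ} (hρ : IsScalingConstant R ρ) (hc : 0 < c)
    (hr : 0 < r) (h : ∀ n, 1 ≤ n → 0 < R n ∧ R n ≤ c * r ^ n) : ρ ≤ r :=
  (Real.log_le_log_iff hρ.1 hr).1 <|
    le_of_tendsto_of_tendsto hρ.2 (tendsto_log_div_add_log c r) (eventually_log_div_le hc hr h)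

end Hexacarpet

open Hexacarpet

theorem mainTheorem6 (κ β : ℝ) (hκ : 0 < κ) (hβ : 0 < β) :
    -- the shorted hexacarpet graph is the graph approximation of the six-cell gasket
    (∀ n : ℕ, ∃ φ : Hexacarpet.VShort n ≃ (Hexacarpet.gasket κ n).V,
      (∀ P Q : Hexacarpet.VShort n,
        (Hexacarpet.gasket κ n).cond (φ P) (φ Q) = Hexacarpet.condShort κ n P Q) ∧
      ∀ k : Fin 3, φ '' Hexacarpet.shortImage n (Hexacarpet.sideH n k) =
        {(Hexacarpet.gasket κ n).cor k}) ∧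
    -- its resistance scales exactly by `5/4`
    (∀ (n : ℕ) (i j : Fin 3), i ≠ j →
      0 < Hexacarpet.RShort κ n i j ∧
      Hexacarpet.RShort κ (n + 1) i j = 5 / 4 * Hexacarpet.RShort κ n i j) ∧
    (∀ n : ℕ, 1 ≤ n →
      0 < Hexacarpet.RShortAB κ n ∧
      Hexacarpet.RShortAB κ (n + 1) = 5 / 4 * Hexacarpet.RShortAB κ n ∧
      Hexacarpet.RShortAB κ n ≤ Hexacarpet.RH κ n) ∧
    -- `R_n ≥ c (5/4)^n`, and thus `ρ ≥ 5/4`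
    (∃ c : ℝ, 0 < c ∧ ∀ n : ℕ, 1 ≤ n → c * (5 / 4) ^ n ≤ Hexacarpet.RH κ n) ∧
    ((Real.log (5 / 4) : ℝ) : EReal) ≤
      Filter.liminf (fun n : ℕ => ((Real.log (Hexacarpet.RH κ n) / n : ℝ) : EReal))
        Filter.atTop ∧
    (∀ ρ : ℝ, Hexacarpet.IsScalingConstant (Hexacarpet.RH κ) ρ → 5 / 4 ≤ ρ) ∧
    -- `ρ^T ≤ 4/5`
    (∃ C : ℝ, ∀ n : ℕ, 1 ≤ n →
      0 < Hexacarpet.RT β n ∧ Hexacarpet.RT β n ≤ C * (4 / 5) ^ n) ∧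
    Filter.limsup (fun n : ℕ => ((Real.log (Hexacarpet.RT β n) / n : ℝ) : EReal))
        Filter.atTop ≤ ((Real.log (4 / 5) : ℝ) : EReal) ∧
    (∀ ρT : ℝ, Hexacarpet.IsScalingConstant (Hexacarpet.RT β) ρT → ρT ≤ 4 / 5) := by

  have hRH : ∀ n, 1 ≤ n → 3 / (2 * κ) * (5 / 4) ^ n ≤ RH κ n := fun n hn => by
    obtain ⟨n, rfl⟩ := Nat.exists_eq_add_of_le' hn
    refine le_of_eq_of_le ?_ (inv_traceCond_le_RH hκ n)
    rw [traceCond, show (5 / 4 : ℝ) = (4 / 5)⁻¹ by norm_num, inv_pow]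
    field_simp
  have hc : 0 < 3 / (2 * κ) := by positivity
  have hRT : ∀ n, 1 ≤ n → 0 < RT β n ∧ RT β n ≤ max 2 β⁻¹ * (2 / 3) * (4 / 5) ^ n :=
      fun n hn => by
    obtain ⟨n, rfl⟩ := Nat.exists_eq_add_of_le' hn
    exact RT_pos_and_le hβ n
  have hC : (0 : ℝ) < max 2 β⁻¹ * (2 / 3) :=
    mul_pos (lt_max_of_lt_left two_pos) (by norm_num)
  refine ⟨exists_equiv_gasket κ, fun n i j hij => ?_, fun n hn => ?_, ⟨_, hc, hRH⟩,
    log_le_liminf hc (by norm_num) hRH, fun ρ hρ => hρ.le hc (by norm_num) hRH, ⟨_, hRT⟩,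
    limsup_le_log hC (by norm_num) hRT, fun ρ hρ => hρ.ge hC (by norm_num) hRT⟩
  · have ht := traceCond_pos hκ n
    rw [RShort_eq hκ _ hij, RShort_eq hκ _ hij, traceCond_succ]
    exact ⟨by positivity, by field_simp⟩
  · obtain ⟨n, rfl⟩ := Nat.exists_eq_add_of_le' hn
    have ht := traceCond_pos hκ (n + 1)
    rw [RShortAB_succ_eq hκ, RShortAB_succ_eq hκ, traceCond_succ κ (n + 1)]
    exact ⟨by positivity, by field_simp, inv_traceCond_le_RH hκ n⟩
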